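/- Write $[n]=\{1,\dots,n\}$. For $D\subseteq\{(i,j)\in[n]\times[n]: i+j\le n\}$ (matrix coordinates), the wiring diagram of $D$ has a crossing tile at each cell of $D$ (joining its left edge to its right edge and its bottom edge to its top edge) and at each other cell two paths avoiding each other (joining left to top and bottom to right); its $n$ pipes start at the left ends of rows $1,\dots,n$ and end at the tops of columns $1,\dots,n$. $D$ is a *reduced pipe dream* of $w\in S_n$ if no two pipes cross more than once and, for each $i$, the pipe starting in row $i$ ends in column $w(i)$. Let $\mathcal{PD}(w)$ be the set of these. Let $z\in S_n$ be a fixed-point-free involution (so $n$ is even). Put $1^{\mathsf{fpf}}_n=(1,2)(3,4)\cdots(n-1,n)$, let $\mathcal A^{\mathsf{fpf}}(z)$ be the set of minimal-length $w\in S_n$ with $z=w^{-1}1^{\mathsf{fpf}}_n w$, and let $\mathcal{FD}^+(z)=\bigcup_{w\in\mathcal A^{\mathsf{fpf}}(z)}\mathcal{PD}(w)$. Let $T_n=\{(j,i)\in[n]\times[n]: i<j\}$ and $\mathcal{FD}(z)=\{D\cap T_n : D\in\mathcal{PD}(z),\ D=D^T\}$. For $i\in[n]$ let $\hat c_i(z)$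 be the number of $j>i$ with $z(i)>z(j)$ and $i>z(j)$, and let $B_z=\{(i,j)\in[n]\times[n]: j\le\hat c_i(z)\}$. For $D,E\subseteq\mathbb Z_{>0}\times\mathbb Z_{>0}$: * $E$ is obtained from $D$ by a *ladder move* if there are integers $0<i<j$ and $k\ge1$ with $\{i+1,\dots,j-1\}\times\{k,k+1\}\subseteq D$, $(j,k)\in D$, $(i,k),(i,k+1),(j,k+1)\notin D$ and $E=(D\setminus\{(j,k)\})\cup\{(i,k+1)\}$. * $E$ is obtained from $D$ by an *fpf ladder move* if there are integers $0<i<j$ and $k\ge2$ with $\{i+1,\dots,j-1\}\times\{k,k+1\}\subseteq D$, $(i,k),(j,k)\in D$, $(i,k-1),(i,k+1),(i,k+2),(j,k+1)\notin D$, $E=(D\setminus\{(j,k)\})\cup\{(i,k-1)\}$, and $D$ contains no $(a,b)$ with $a<i$ and $a+b\in\{i+k-2,i+k-1,i+k,i+k+1,i+k+2\}$. Let $\le$ be the reflexive transitive closure of the union of these two relations, and write $D\sim E$ if $D\le E$ or $E\le D$. **Theorem.** For every $n$ and every fixed-point-free involution $z\in S_n$, $$\mathcal{FD}^+(z)=\{E: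 B_z\le E\}=\{E: B_z\sim E\}.$$ Moreover $\mathcal{FD}^+(z)$ is an upper and a lower set of $\le$ (if $D\le E$, then $D\in\mathcal{FD}^+(z)$ if and only if $E\in\mathcal{FD}^+(z)$), and $B_z$ is its unique minimum. Finally $$\mathcal{FD}(z)=\{E\subseteq T_n: B_z\le E\}=\{E\subseteq T_n: B_z\sim E\}.$$ -/

import Mathlib

/-!
Conventions. All indices start at `0`: the pair `(r, c) : ℕ × ℕ` is the cell in row `r + 1` and
column `c + 1` (matrix coordinates) of the quadrant of positive integers, and `Fin n` is
`{1, …, n}` shifted by one. So `Set (ℕ × ℕ)` is the type of all subsets of that quadrant.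
-/

namespace FpfPipe

/-! ### Wiring diagrams and reduced pipe dreams -/

/-- Edges of the unit grid: `vert r c` is the left edge and `horiz r c` is the top edge of the cell
`(r, c)`. Thus the right edge of `(r, c)` is `vert r (c + 1)`, its bottom edge is
`horiz (r + 1) c`. -/
inductive Edge : Type
  | vert (r c : ℕ) : Edge
  | horiz (r c : ℕ) : Edge

/-- `PipeThrough D p e`: in the wiring diagram of `D`, the pipe whose left endpoint is in row `p`
passes through the edge `e`. A cell of `D` carries a crossing tile, joining its left edge to its
right edge and its bottom edge to its top edge; a cell outside `D` carries two paths that avoid each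
other, joining left to top and bottom to right. -/
inductive PipeThrough (D : Set (ℕ × ℕ)) (p : ℕ) : Edge → Prop
  | start : PipeThrough D p (Edge.vert p 0)
  | left_cross {r c : ℕ} : PipeThrough D p (Edge.vert r c) → (r, c) ∈ D →
      PipeThrough D p (Edge.vert r (c + 1))
  | left_bend {r c : ℕ} : PipeThrough D p (Edge.vert r c) → (r, c) ∉ D →
      PipeThrough D p (Edge.horiz r c)
  | bottom_cross {r c : ℕ} : PipeThrough D p (Edge.horiz (r + 1) c) → (r, c) ∈ D →
      PipeThrough D p (Edge.horiz r c)
  | bottom_bend {r c : ℕ} : PipeThrough D p (Edge.horiz (r + 1) c) → (r, c) ∉ D →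
      PipeThrough D p (Edge.vert r (c + 1))

/-- The pipes `p` and `q` cross at the cell `x`, with `p` running horizontally and `q` vertically,
or the other way round. -/
def PipesCrossAt (D : Set (ℕ × ℕ)) (p q : ℕ) (x : ℕ × ℕ) : Prop :=
  x ∈ D ∧
    ((PipeThrough D p (Edge.vert x.1 x.2) ∧ PipeThrough D q (Edge.horiz (x.1 + 1) x.2)) ∨
     (PipeThrough D q (Edge.vert x.1 x.2) ∧ PipeThrough D p (Edge.horiz (x.1 + 1) x.2)))

/-- The triangle `{(i, j) ∈ [n] × [n] : i + j ≤ n}`. -/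
def upperTriangle (n : ℕ) : Set (ℕ × ℕ) := {x | x.1 + x.2 + 2 ≤ n}

/-- `D` is a reduced pipe dream of size `n`: it lies in the triangle and no two of its `n` pipes
cross more than once. -/
def IsReducedPipeDream (n : ℕ) (D : Set (ℕ × ℕ)) : Prop :=
  D ⊆ upperTriangle n ∧
    ∀ p q : ℕ, p < n → q < n → p ≠ q →
      ∀ x y : ℕ × ℕ, PipesCrossAt D p q x → PipesCrossAt D p q y → x = y

/-- The set of reduced pipe dreams of `w`: the pipe with left endpoint `i` has top endpoint
`w i`. -/
def PD {n : ℕ} (w : Equiv.Perm (Fin n)) : Set (Set (ℕ × ℕ)) :=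
  {D | IsReducedPipeDream n D ∧ ∀ i : Fin n, PipeThrough D i (Edge.horiz 0 (w i))}

/-! ### Fixed-point-free involutions and their atoms -/

/-- `z` is a fixed-point-free involution. -/
def IsFpfInvolution {n : ℕ} (z : Equiv.Perm (Fin n)) : Prop :=
  (∀ i, z (z i) = i) ∧ ∀ i, z i ≠ i

/-- The underlying function of `(1,2)(3,4)⋯(n-1,n)`; for odd `n` the last letter is fixed. -/
def baseFun (n : ℕ) (i : Fin n) : Fin n :=
  if i.1 % 2 = 1 then ⟨i.1 - 1, by omega⟩
  else if h : i.1 + 1 < n then ⟨i.1 + 1, h⟩ else i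

theorem baseFun_involutive (n : ℕ) : Function.Involutive (baseFun n) := by
  intro i
  apply Fin.ext
  simp only [baseFun]
  split_ifs <;> simp_all <;> omega

/-- The permutation `(1,2)(3,4)⋯(n-1,n)`, a fixed-point-free involution when `n` is even. -/
def fpfBase (n : ℕ) : Equiv.Perm (Fin n) := (baseFun_involutive n).toPerm

/-- The Coxeter length of a permutation, as its number of inversions. -/
def len {n : ℕ} (w : Equiv.Perm (Fin n)) : ℕ :=
  (Finset.univ.filter fun x : Fin n × Fin n => x.1 < x.2 ∧ w x.2 < w x.1).card

/-- `w` is an fpf-atom of `z`: it has minimal length among the `v` with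
`z = v⁻¹ (1,2)(3,4)⋯(n-1,n) v`. -/
def IsFpfAtom {n : ℕ} (z w : Equiv.Perm (Fin n)) : Prop :=
  z = w⁻¹ * fpfBase n * w ∧ ∀ v : Equiv.Perm (Fin n), z = v⁻¹ * fpfBase n * v → len w ≤ len v

/-- The union of the sets `PD w` over all fpf-atoms `w` of `z`. -/
def FDPlus {n : ℕ} (z : Equiv.Perm (Fin n)) : Set (Set (ℕ × ℕ)) :=
  {D | ∃ w : Equiv.Perm (Fin n), IsFpfAtom z w ∧ D ∈ PD w}

/-- The strict lower triangle `{(j, i) ∈ [n] × [n] : i < j}`. -/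
def strictLowerTriangle (n : ℕ) : Set (ℕ × ℕ) := {x | x.1 < n ∧ x.2 < x.1}

/-- The fpf-involution pipe dreams of `z`: the intersections with the strict lower triangle of the
symmetric reduced pipe dreams of `z`. -/
def FD {n : ℕ} (z : Equiv.Perm (Fin n)) : Set (Set (ℕ × ℕ)) :=
  {E | ∃ D ∈ PD z, (∀ i j : ℕ, (i, j) ∈ D → (j, i) ∈ D) ∧ E = D ∩ strictLowerTriangle n}

/-- The `i`-th entry of the fpf-involution code: the number of `j > i` with `z i > z j` and
`i > z j`. -/
def fpfCode {n : ℕ} (z : Equiv.Perm (Fin n)) (i : Fin n) : ℕ :=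
  (Finset.univ.filter fun j : Fin n => i < j ∧ z j < z i ∧ z j < i).card

/-- The bottom fpf-involution pipe dream: the first `fpfCode z i` cells of each row `i`. -/
def bottomFpf {n : ℕ} (z : Equiv.Perm (Fin n)) : Set (ℕ × ℕ) :=
  {x | ∃ h : x.1 < n, x.2 < fpfCode z ⟨x.1, h⟩}

/-! ### Ladder moves -/

/-- `E` is obtained from `D` by an ordinary ladder move. -/
def LadderMove (D E : Set (ℕ × ℕ)) : Prop :=
  ∃ i j k : ℕ, i < j ∧
    (∀ m, i < m → m < j → (m, k) ∈ D ∧ (m, k + 1) ∈ D) ∧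
    (j, k) ∈ D ∧ (i, k) ∉ D ∧ (i, k + 1) ∉ D ∧ (j, k + 1) ∉ D ∧
    E = (D \ {(j, k)}) ∪ {(i, k + 1)}

/-- `E` is obtained from `D` by an fpf ladder move. With rows and columns numbered from `0` the
condition on the column is `1 ≤ k`. The last condition says that `D` has no cell `(a, b)` strictly
northeast of, and on the same antidiagonal as, one of `(i, k-2)`, `(i, k-1)`, `(i, k)`, `(i, k+1)`,
`(i, k+2)`: the sum `a + b` is none of `i + k - 2, …, i + k + 2` if `a < i`. -/
def FpfLadderMove (D E : Set (ℕ × ℕ)) : Prop :=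
  ∃ i j k : ℕ, i < j ∧ 1 ≤ k ∧
    (∀ m, i < m → m < j → (m, k) ∈ D ∧ (m, k + 1) ∈ D) ∧
    (i, k) ∈ D ∧ (j, k) ∈ D ∧
    (i, k - 1) ∉ D ∧ (i, k + 1) ∉ D ∧ (i, k + 2) ∉ D ∧ (j, k + 1) ∉ D ∧
    E = (D \ {(j, k)}) ∪ {(i, k - 1)} ∧
    ∀ a b : ℕ, a < i → i + k ≤ a + b + 2 → a + b ≤ i + k + 2 → (a, b) ∉ D

/-- The order `≤` generated by ladder moves and fpf ladder moves: `E` is reached from `D` by finitely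
many (possibly zero) such moves. -/
def FDLe : Set (ℕ × ℕ) → Set (ℕ × ℕ) → Prop :=
  Relation.ReflTransGen fun D E => LadderMove D E ∨ FpfLadderMove D E

/-- The symmetric closure of `FDLe`. -/
def FDSim (D E : Set (ℕ × ℕ)) : Prop := FDLe D E ∨ FDLe E D

end FpfPipe

namespace FpfPipe

/-! ### Adjacent transpositions -/

/-! Give the cell `(r, c)` the letter `adj n (r + c)` and read the cells of `D` from northeast to
southwest. Cells that are incomparable in this order have commuting letters, so the product
`dreamPerm n D` is well defined. Sweeping a lattice path over the tiles shows that pipes realize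
this product and that crossings record its inversions. Hence `D` is a reduced pipe dream of `w`
exactly when it lies in the triangle, has product `w` and has `len w` cells (`mem_PD_iff`), and
membership in `FDPlus z` becomes a statement about shortest words for elements conjugating the base
involution to `z` (`IsFpfDream`).

Invariance under moves. An ordinary ladder move preserves the product, by repeated braid relations.
For an fpf ladder move, the emptiness conditions allow the affected letters to be brought to the
front, so that the two words start with `s_a s_{a+1}` and `s_a s_{a-1}` and then agree. Minimality
forces `a` to be odd in the indexing from `0`, because even letters centralize the base involution
and could be deleted. For odd `a` the two prefixes conjugate the base involution to the same element
(`conj_adj_mul_adj_mul`). So `FDPlus z` is closed under moves in both directions.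

Connectedness. An element that is not left-justified admits an inverse ladder move
(`exists_ladderMove`). A left-justified one is determined by the Lehmer code of its atom. Either
that code is the fpf code, which gives `bottomFpf z`, or the atom orders two cycles of `z` wrongly,
and then an inverse fpf ladder move exists (`lehmer_eq_fpfCode_or`, `exists_fpfLadderMove`). Moves
keep the number of cells and lower the sum of the row indices. Hence descent ends at `bottomFpf z`,
and the order is antisymmetric.

Symmetric dreams. A symmetric set with strictly lower part `L` and diagonal part `Δ` has product
`u⁻¹ δ u`, where `u` and `δ` are the products of `L` and `Δ`. As `z` has no fixed points, the
diagonal must be full, and then `δ` is the base involution. The count `2 * len z = 4 * ∑ i, fpfCode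
z i + n` matches reducedness of the symmetric set with minimality of `L` (`mem_FD_iff`). -/

/-- The transposition of `a` and `a + 1` in `Fin n`, or `1` if there is none. -/
def adj (n a : ℕ) : Equiv.Perm (Fin n) :=
  if h : a + 1 < n then Equiv.swap ⟨a, by omega⟩ ⟨a + 1, h⟩ else 1

theorem adj_val {n a : ℕ} (h : a + 1 < n) (i : Fin n) :
    (adj n a i : ℕ) = if i.1 = a then a + 1 else if i.1 = a + 1 then a else i.1 := by
  simp only [adj, dif_pos h, Equiv.swap_apply_def, Fin.ext_iff]
  split_ifs <;> rfl

theorem adj_of_le {n a : ℕ} (h : n ≤ a + 1) : adj n a = 1 := by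
  simp [adj, Nat.not_lt.mpr h]

theorem adj_mul_self (n a : ℕ) : adj n a * adj n a = 1 := by
  unfold adj
  split_ifs <;> simp

theorem adj_inv (n a : ℕ) : (adj n a)⁻¹ = adj n a :=
  inv_eq_of_mul_eq_one_left (adj_mul_self n a)

theorem adj_commute_of_le {n a b : ℕ} (h : a + 2 ≤ b) : Commute (adj n a) (adj n b) := by
  by_cases hb : b + 1 < n
  · have ha : a + 1 < n := by omega
    refine Equiv.ext fun i => Fin.ext ?_
    simp only [Equiv.Perm.mul_apply, adj_val ha, adj_val hb]
    grind
  · rw [adj_of_le (not_lt.mp hb)]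
    exact Commute.one_right _

theorem adj_commute {n a b : ℕ} (h : a + 2 ≤ b ∨ b + 2 ≤ a) : Commute (adj n a) (adj n b) :=
  h.elim adj_commute_of_le fun h => (adj_commute_of_le h).symm

theorem adj_braid {n a : ℕ} (h : a + 2 < n) :
    adj n a * (adj n (a + 1) * adj n a) = adj n (a + 1) * adj n a * adj n (a + 1) := by
  have h1 : a + 1 < n := by omega
  have h2 : a + 1 + 1 < n := by omega
  refine Equiv.ext fun i => Fin.ext ?_
  simp only [Equiv.Perm.mul_apply, adj_val h1, adj_val h2]
  grind

/-! ### Length -/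

/-- The inversions of a permutation. -/
def invs {n : ℕ} (w : Equiv.Perm (Fin n)) : Finset (Fin n × Fin n) :=
  Finset.univ.filter fun x : Fin n × Fin n => x.1 < x.2 ∧ w x.2 < w x.1

theorem mem_invs {n : ℕ} {w : Equiv.Perm (Fin n)} {p q : Fin n} :
    (p, q) ∈ invs w ↔ p < q ∧ w q < w p := by simp [invs]

theorem card_invs {n : ℕ} (w : Equiv.Perm (Fin n)) : (invs w).card = len w := rfl

theorem len_one (n : ℕ) : len (1 : Equiv.Perm (Fin n)) = 0 := by
  rw [← card_invs, Finset.card_eq_zero, Finset.eq_empty_iff_forall_notMem]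
  rintro ⟨p, q⟩ h
  rw [mem_invs] at h
  exact absurd h.1 (not_lt.mpr h.2.le)

theorem adj_lt_adj {n a : ℕ} (ha : a + 1 < n) {i j : Fin n}
    (h : ¬ (i.1 = a ∧ j.1 = a + 1)) (h' : ¬ (i.1 = a + 1 ∧ j.1 = a)) :
    adj n a i < adj n a j ↔ i < j := by
  simp only [Fin.lt_def, adj_val ha]
  split_ifs <;> omega

/-- Left multiplication exchanges the values `a` and `a + 1`, so it changes the relative order of
values only at the pair of positions carrying them. -/
theorem invs_adj_mul {n a : ℕ} (ha : a + 1 < n) (u : Equiv.Perm (Fin n)) {p q : Fin n}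
    (hp : (u p).1 = a) (hq : (u q).1 = a + 1) (hpq : p < q) :
    invs (adj n a * u) = insert (p, q) (invs u) := by
  have key : ∀ {r : Fin n}, (u r).1 = a → r = p := fun h =>
    u.injective (Fin.ext (h.trans hp.symm))
  have key' : ∀ {r : Fin n}, (u r).1 = a + 1 → r = q := fun h =>
    u.injective (Fin.ext (h.trans hq.symm))
  ext ⟨r, t⟩
  rw [Finset.mem_insert, mem_invs, mem_invs, Equiv.Perm.mul_apply, Equiv.Perm.mul_apply,
    Prod.mk.injEq]
  by_cases h1 : (u t).1 = a ∧ (u r).1 = a + 1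
  · have e1 := key h1.1
    have e2 := key' h1.2
    subst e1 e2
    constructor
    · exact fun h => absurd hpq (not_lt.mpr h.1.le)
    · rintro (⟨h, -⟩ | ⟨h, -⟩)
      · exact absurd h hpq.ne'
      · exact absurd hpq (not_lt.mpr h.le)
  by_cases h2 : (u t).1 = a + 1 ∧ (u r).1 = a
  · have e1 := key' h2.1
    have e2 := key h2.2
    subst e1 e2
    refine ⟨fun _ => Or.inl ⟨rfl, rfl⟩, fun _ => ⟨hpq, ?_⟩⟩
    rw [Fin.lt_def, adj_val ha, adj_val ha, hp, hq]
    simp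
  · rw [adj_lt_adj ha h1 h2]
    constructor
    · exact Or.inr
    · rintro (⟨rfl, rfl⟩ | h)
      · exact absurd ⟨hq, hp⟩ h2
      · exact h

theorem len_adj_mul_of_lt {n a : ℕ} (ha : a + 1 < n) (u : Equiv.Perm (Fin n)) {p q : Fin n}
    (hp : (u p).1 = a) (hq : (u q).1 = a + 1) (hpq : p < q) :
    len (adj n a * u) = len u + 1 := by
  rw [← card_invs, invs_adj_mul ha u hp hq hpq, Finset.card_insert_of_notMem, card_invs]
  intro h
  have h2 := (mem_invs.mp h).2
  rw [Fin.lt_def, hp, hq] at h2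
  omega

theorem len_adj_mul_of_gt {n a : ℕ} (ha : a + 1 < n) (u : Equiv.Perm (Fin n)) {p q : Fin n}
    (hp : (u p).1 = a) (hq : (u q).1 = a + 1) (hpq : q < p) :
    len (adj n a * u) + 1 = len u := by
  rw [← len_adj_mul_of_lt ha (adj n a * u) (p := q) (q := p) _ _ hpq, ← mul_assoc, adj_mul_self,
    one_mul]
  · rw [Equiv.Perm.mul_apply, adj_val ha, hq]; simp
  · rw [Equiv.Perm.mul_apply, adj_val ha, hp]; simp

theorem len_adj_mul_le {n : ℕ} (a : ℕ) (u : Equiv.Perm (Fin n)) :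
    len (adj n a * u) ≤ len u + 1 := by
  by_cases ha : a + 1 < n
  · have hp : (u (u⁻¹ ⟨a, by omega⟩)).1 = a := by simp
    have hq : (u (u⁻¹ ⟨a + 1, ha⟩)).1 = a + 1 := by simp
    rcases lt_trichotomy (u⁻¹ ⟨a, by omega⟩) (u⁻¹ ⟨a + 1, ha⟩) with h | h | h
    · exact (len_adj_mul_of_lt ha u hp hq h).le
    · rw [h, hq] at hp; omega
    · have := len_adj_mul_of_gt ha u hp hq h; omega
  · rw [adj_of_le (not_lt.mp ha), one_mul]; omega

/-! ### Readings of finite sets of cells -/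

/-- The cell `x` lies weakly northeast of `y`. -/
def Before (x y : ℕ × ℕ) : Prop := x ≠ y ∧ x.1 ≤ y.1 ∧ y.2 ≤ x.2

/-- `L` lists the cells of `D` in an order compatible with `Before`. -/
def IsReading (D : Finset (ℕ × ℕ)) (L : List (ℕ × ℕ)) : Prop :=
  L.Nodup ∧ (∀ x, x ∈ L ↔ x ∈ D) ∧ L.Pairwise fun x y => ¬ Before y x

/-- The product of the transpositions attached to the cells of a list. -/
def wordProd (n : ℕ) (L : List (ℕ × ℕ)) : Equiv.Perm (Fin n) :=
  (L.map fun x => adj n (x.1 + x.2)).prod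

theorem wordProd_nil (n : ℕ) : wordProd n [] = 1 := rfl

theorem wordProd_cons (n : ℕ) (x : ℕ × ℕ) (L : List (ℕ × ℕ)) :
    wordProd n (x :: L) = adj n (x.1 + x.2) * wordProd n L := by simp [wordProd]

theorem wordProd_append (n : ℕ) (L L' : List (ℕ × ℕ)) :
    wordProd n (L ++ L') = wordProd n L * wordProd n L' := by simp [wordProd]

theorem wordProd_reverse_swap (n : ℕ) (L : List (ℕ × ℕ)) :
    wordProd n (L.map Prod.swap).reverse = (wordProd n L)⁻¹ := by
  induction L with
  | nil => simp [wordProd_nil]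
  | cons x L ih =>
    rw [List.map_cons, List.reverse_cons, wordProd_append, ih, wordProd_cons, wordProd_cons,
      wordProd_nil, mul_inv_rev, adj_inv, mul_one, Prod.fst_swap, Prod.snd_swap, add_comm x.2]

theorem commute_wordProd {n a : ℕ} {L : List (ℕ × ℕ)}
    (h : ∀ x ∈ L, a + 2 ≤ x.1 + x.2 ∨ x.1 + x.2 + 2 ≤ a) :
    Commute (adj n a) (wordProd n L) := by
  induction L with
  | nil => exact Commute.one_right _
  | cons x L ih =>
    rw [wordProd_cons]
    exact (adj_commute (h x List.mem_cons_self)).mul_right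
      (ih fun y hy => h y (List.mem_cons_of_mem _ hy))

/-- Of two distinct incomparable cells, one lies strictly southeast of the other, so both
coordinates increase and the letters commute. -/
theorem label_of_not_before {x y : ℕ × ℕ} (hne : x ≠ y) (h : ¬ Before x y) (h' : ¬ Before y x) :
    x.1 + x.2 + 2 ≤ y.1 + y.2 ∨ y.1 + y.2 + 2 ≤ x.1 + x.2 := by
  have hne' := hne.symm
  simp only [Before, ne_eq, hne, hne', not_false_eq_true, true_and, not_and, not_le] at h h'
  have : x.1 ≠ y.1 ∨ x.2 ≠ y.2 := by
    by_contra hc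
    push Not at hc
    exact hne (Prod.ext hc.1 hc.2)
  omega

theorem exists_reading (D : Finset (ℕ × ℕ)) : ∃ L, IsReading D L := by
  induction D using Finset.strongInduction with
  | H D ih =>
    rcases D.eq_empty_or_nonempty with rfl | hD
    · exact ⟨[], by simp [IsReading]⟩
    · obtain ⟨x, hx, hmin⟩ := D.exists_min_image (fun x => (x.1 : ℤ) - x.2) hD
      obtain ⟨L, hL1, hL2, hL3⟩ := ih (D.erase x) (Finset.erase_ssubset hx)
      refine ⟨x :: L, ?_, ?_, ?_⟩
      · rw [List.nodup_cons, hL2]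
        exact ⟨by simp, hL1⟩
      · intro y
        rw [List.mem_cons, hL2, Finset.mem_erase]
        by_cases h : y = x
        · simp [h, hx]
        · simp [h]
      · rw [List.pairwise_cons]
        refine ⟨fun y hy hb => ?_, hL3⟩
        rw [hL2, Finset.mem_erase] at hy
        have h1 := hmin y hy.2
        obtain ⟨h2, h3, h4⟩ := hb
        refine h2 (Prod.ext ?_ ?_) <;> omega

/-- The first cell of `L` can be pulled to the front of `L'`: each cell that precedes it there is
incomparable with it, so their letters commute. Induction handles the rest. -/
theorem IsReading.wordProd_eq {n : ℕ} {D : Finset (ℕ × ℕ)} {L L' : List (ℕ × ℕ)}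
    (h : IsReading D L) (h' : IsReading D L') : wordProd n L = wordProd n L' := by
  induction L generalizing D L' with
  | nil =>
    cases L' with
    | nil => rfl
    | cons x L' =>
      have := (h.2.1 x).mpr ((h'.2.1 x).mp List.mem_cons_self)
      simp at this
  | cons x L ih =>
    have hx : x ∈ L' := (h'.2.1 x).mpr ((h.2.1 x).mp List.mem_cons_self)
    obtain ⟨A, B, rfl⟩ := List.append_of_mem hx
    obtain ⟨h1, h2, h3⟩ := h
    obtain ⟨h1', h2', h3'⟩ := h'
    rw [List.nodup_cons] at h1
    rw [List.pairwise_cons] at h3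
    have hnd := List.nodup_middle.mp h1'
    rw [List.nodup_cons] at hnd
    have hAB : ∀ y, y ∈ A ++ B ↔ y ∈ L := by
      intro y
      have e := (h2' y).trans (h2 y).symm
      by_cases hy : y = x
      · subst hy
        exact iff_of_false hnd.1 h1.1
      · simpa [hy] using e
    rw [List.pairwise_append, List.pairwise_cons] at h3'
    rw [wordProd_cons, wordProd_append, wordProd_cons, ← mul_assoc,
      ← (commute_wordProd (n := n) (a := x.1 + x.2) (L := A) _).eq, mul_assoc,
      ← wordProd_append]
    · congr 1
      refine ih (D := L.toFinset) ⟨h1.2, by simp, h3.2⟩ ⟨hnd.2, by simp [← hAB], ?_⟩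
      rw [List.pairwise_append]
      exact ⟨h3'.1, h3'.2.1.2, fun y hy t ht => h3'.2.2 y hy t (List.mem_cons_of_mem _ ht)⟩
    · intro y hy
      have hyL : y ∈ L := (hAB y).mp (List.mem_append_left _ hy)
      refine label_of_not_before ?_ (h3'.2.2 y hy x List.mem_cons_self) (h3.1 y hyL)
      rintro rfl
      exact h1.1 hyL

/-! ### The permutation of a finite set of cells -/

/-- The product of the transpositions attached to the cells of `D`, from northeast to southwest. -/
noncomputable def dreamPerm (n : ℕ) (D : Finset (ℕ × ℕ)) : Equiv.Perm (Fin n) :=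
  wordProd n (exists_reading D).choose

theorem IsReading.dreamPerm_eq {n : ℕ} {D : Finset (ℕ × ℕ)} {L : List (ℕ × ℕ)}
    (h : IsReading D L) : dreamPerm n D = wordProd n L :=
  (exists_reading D).choose_spec.wordProd_eq h

theorem dreamPerm_empty (n : ℕ) : dreamPerm n ∅ = 1 := by
  rw [IsReading.dreamPerm_eq (L := []) (by simp [IsReading]), wordProd_nil]

theorem dreamPerm_singleton (n : ℕ) (x : ℕ × ℕ) : dreamPerm n {x} = adj n (x.1 + x.2) := by
  rw [IsReading.dreamPerm_eq (L := [x]) (by simp [IsReading]), wordProd_cons, wordProd_nil, mul_one]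

theorem dreamPerm_union (n : ℕ) {D E : Finset (ℕ × ℕ)}
    (h : ∀ x ∈ D, ∀ y ∈ E, x ≠ y ∧ ¬ Before y x) :
    dreamPerm n (D ∪ E) = dreamPerm n D * dreamPerm n E := by
  obtain ⟨L, hL⟩ := exists_reading D
  obtain ⟨M, hM⟩ := exists_reading E
  rw [hL.dreamPerm_eq, hM.dreamPerm_eq, ← wordProd_append]
  refine IsReading.dreamPerm_eq ⟨?_, ?_, ?_⟩
  · rw [List.nodup_append]
    refine ⟨hL.1, hM.1, fun x hx y hy => ?_⟩
    exact (h x ((hL.2.1 x).mp hx) y ((hM.2.1 y).mp hy)).1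
  · intro x
    rw [List.mem_append, Finset.mem_union, hL.2.1, hM.2.1]
  · rw [List.pairwise_append]
    exact ⟨hL.2.2, hM.2.2, fun x hx y hy => (h x ((hL.2.1 x).mp hx) y ((hM.2.1 y).mp hy)).2⟩

/-- Transposition preserves letters and reverses the reading order. -/
theorem dreamPerm_swap (n : ℕ) (D : Finset (ℕ × ℕ)) :
    dreamPerm n (D.image Prod.swap) = (dreamPerm n D)⁻¹ := by
  obtain ⟨L, h1, h2, h3⟩ := exists_reading D
  rw [IsReading.dreamPerm_eq ⟨h1, h2, h3⟩, ← wordProd_reverse_swap]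
  refine IsReading.dreamPerm_eq ⟨?_, ?_, ?_⟩
  · rw [List.nodup_reverse]
    exact h1.map Prod.swap_injective
  · intro x
    simp [h2]
  · rw [List.pairwise_reverse, List.pairwise_map]
    refine h3.imp fun {x y} h hb => h ⟨fun e => hb.1 (by rw [e]), hb.2.2, hb.2.1⟩

theorem commute_dreamPerm {n a : ℕ} {D : Finset (ℕ × ℕ)}
    (h : ∀ x ∈ D, a + 2 ≤ x.1 + x.2 ∨ x.1 + x.2 + 2 ≤ a) :
    Commute (adj n a) (dreamPerm n D) := by
  obtain ⟨L, hL⟩ := exists_reading D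
  rw [hL.dreamPerm_eq]
  exact commute_wordProd fun x hx => h x ((hL.2.1 x).mp hx)

theorem len_dreamPerm_mul_le {n : ℕ} (D : Finset (ℕ × ℕ)) (u : Equiv.Perm (Fin n)) :
    len (dreamPerm n D * u) ≤ D.card + len u := by
  obtain ⟨L, hL⟩ := exists_reading D
  have hc : D.card = L.length := by
    rw [← List.toFinset_card_of_nodup hL.1]
    congr 1
    ext x
    simp [hL.2.1]
  rw [hL.dreamPerm_eq, hc]
  clear hL hc
  induction L with
  | nil => simp [wordProd_nil]
  | cons x L ih =>
    rw [wordProd_cons, mul_assoc, List.length_cons]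
    have := len_adj_mul_le (x.1 + x.2) (wordProd n L * u)
    omega

theorem len_dreamPerm_le {n : ℕ} (D : Finset (ℕ × ℕ)) : len (dreamPerm n D) ≤ D.card := by
  simpa [len_one] using len_dreamPerm_mul_le D (1 : Equiv.Perm (Fin n))

/-! ### Pipes and permutations -/

/-- A pipe can be traced backwards: the tile preceding an edge determines the edge by which it was
entered. -/
theorem pipeThrough_unique {D : Set (ℕ × ℕ)} {p q : ℕ} {e : Edge} (hp : PipeThrough D p e)
    (hq : PipeThrough D q e) : p = q := by
  induction hp with
  | start => cases hq; rfl
  | left_cross _ hm ih =>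
    cases hq with
    | left_cross h _ => exact ih h
    | bottom_bend _ hm' => exact absurd hm hm'
  | left_bend _ hm ih =>
    cases hq with
    | left_bend h _ => exact ih h
    | bottom_cross _ hm' => exact absurd hm' hm
  | bottom_cross _ hm ih =>
    cases hq with
    | bottom_cross h _ => exact ih h
    | left_bend _ hm' => exact absurd hm hm'
  | bottom_bend _ hm ih =>
    cases hq with
    | bottom_bend h _ => exact ih h
    | left_cross _ hm' => exact absurd hm' hm

/-- The `ℓ`-th edge of the lattice path that separates the cells south of row `r`, and the first `c`
cells of row `r`, from the other cells. -/
def frontier (r c ℓ : ℕ) : Edge :=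
  if ℓ < r then Edge.vert ℓ 0
  else if ℓ < r + c then Edge.horiz r (ℓ - r)
  else if ℓ = r + c then Edge.vert r c
  else Edge.horiz (r + 1) (ℓ - r - 1)

theorem frontier_self (r c : ℕ) : frontier r c (r + c) = Edge.vert r c := by
  simp [frontier]

theorem frontier_self_succ (r c : ℕ) : frontier r c (r + c + 1) = Edge.horiz (r + 1) c := by
  have : r + c + 1 - r - 1 = c := by omega
  simp only [frontier, this]
  split_ifs <;> first | rfl | omega

theorem frontier_succ_self (r c : ℕ) : frontier r (c + 1) (r + c) = Edge.horiz r c := by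
  have : r + c - r = c := by omega
  simp only [frontier, this]
  split_ifs <;> first | rfl | omega

theorem frontier_succ_self_succ (r c : ℕ) :
    frontier r (c + 1) (r + c + 1) = Edge.vert r (c + 1) := frontier_self r (c + 1)

theorem frontier_succ_of_ne {r c ℓ : ℕ} (h : ℓ ≠ r + c) (h' : ℓ ≠ r + c + 1) :
    frontier r (c + 1) ℓ = frontier r c ℓ := by
  simp only [frontier]
  split_ifs <;> first | rfl | omega

theorem frontier_row {n r ℓ : ℕ} (h : ℓ < n) : frontier r 0 ℓ = frontier (r + 1) n ℓ := by
  simp only [frontier]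
  split_ifs <;> first | rfl | omega | skip
  congr 1
  omega

/-- The cells of `D` southwest of the path `frontier r c`. -/
def below (D : Finset (ℕ × ℕ)) (r c : ℕ) : Finset (ℕ × ℕ) :=
  D.filter fun x => r < x.1 ∨ x.1 = r ∧ x.2 < c

theorem mem_below {D : Finset (ℕ × ℕ)} {r c : ℕ} {x : ℕ × ℕ} :
    x ∈ below D r c ↔ x ∈ D ∧ (r < x.1 ∨ x.1 = r ∧ x.2 < c) := by simp [below]

/-- `D` lies in the triangle `upperTriangle n`. -/
def InTri (n : ℕ) (D : Finset (ℕ × ℕ)) : Prop := ∀ x ∈ D, x.1 + x.2 + 2 ≤ n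

theorem inTri_iff {n : ℕ} {D : Finset (ℕ × ℕ)} : InTri n D ↔ (D : Set (ℕ × ℕ)) ⊆ upperTriangle n :=
  Iff.rfl

theorem below_last {n : ℕ} {D : Finset (ℕ × ℕ)} (hD : InTri n D) (c : ℕ) : below D n c = ∅ := by
  ext x
  simp only [mem_below, Finset.notMem_empty, iff_false, not_and]
  intro hx
  have := hD x hx
  omega

theorem below_zero {n : ℕ} {D : Finset (ℕ × ℕ)} (hD : InTri n D) : below D 0 n = D := by
  ext x
  simp only [mem_below, and_iff_left_iff_imp]
  intro hx
  have := hD x hx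
  omega

theorem below_row {n : ℕ} {D : Finset (ℕ × ℕ)} (hD : InTri n D) (r : ℕ) :
    below D r 0 = below D (r + 1) n := by
  ext x
  simp only [mem_below, and_congr_right_iff]
  intro hx
  have := hD x hx
  omega

theorem below_succ_of_notMem {D : Finset (ℕ × ℕ)} {r c : ℕ} (h : (r, c) ∉ D) :
    below D r (c + 1) = below D r c := by
  ext ⟨i, j⟩
  simp only [mem_below, and_congr_right_iff]
  intro hx
  have : ¬ (i = r ∧ j = c) := by
    rintro ⟨rfl, rfl⟩
    exact h hx
  omega

theorem below_succ_of_mem {D : Finset (ℕ × ℕ)} {r c : ℕ} (h : (r, c) ∈ D) :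
    below D r (c + 1) = {(r, c)} ∪ below D r c := by
  ext ⟨i, j⟩
  simp only [mem_below, Finset.mem_union, Finset.mem_singleton, Prod.mk.injEq]
  constructor
  · rintro ⟨h1, h2⟩
    by_cases h3 : i = r ∧ j = c
    · exact Or.inl h3
    · exact Or.inr ⟨h1, by omega⟩
  · rintro (⟨rfl, rfl⟩ | ⟨h1, h2⟩)
    · exact ⟨h, by omega⟩
    · exact ⟨h1, by omega⟩

theorem card_below_succ_of_mem {D : Finset (ℕ × ℕ)} {r c : ℕ} (h : (r, c) ∈ D) :
    (below D r (c + 1)).card = (below D r c).card + 1 := by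
  rw [below_succ_of_mem h, ← Finset.insert_eq, Finset.card_insert_of_notMem]
  simp [mem_below]

theorem dreamPerm_below_succ {n : ℕ} {D : Finset (ℕ × ℕ)} {r c : ℕ} (h : (r, c) ∈ D) :
    dreamPerm n (below D r (c + 1)) = adj n (r + c) * dreamPerm n (below D r c) := by
  rw [below_succ_of_mem h, dreamPerm_union, dreamPerm_singleton]
  intro x hx y hy
  rw [Finset.mem_singleton] at hx
  subst hx
  rw [mem_below] at hy
  refine ⟨?_, ?_⟩
  · rintro rfl
    simp at hy
  · rintro ⟨h1, h2, h3⟩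
    simp only at h2 h3
    omega

/-- The path sweeps the rows from south to north, each row from west to east, one tile at a time. -/
theorem frontier_induction {n : ℕ} {Q : ℕ → ℕ → Prop} (base : ∀ c, Q n c)
    (row : ∀ r, r < n → Q (r + 1) n → Q r 0)
    (col : ∀ r c, r < n → Q r c → Q r (c + 1)) {r : ℕ} (hr : r ≤ n) (c : ℕ) : Q r c := by
  induction hk : n - r generalizing r c with
  | zero =>
    obtain rfl : r = n := by omega
    exact base c
  | succ k ih =>
    induction c with
    | zero => exact row r (by omega) (ih (by omega) n (by omega))
    | succ c ihc => exact col r c (by omega) ihc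

/-- A crossing tile exchanges the pipes on the edges numbered `r + c` and `r + c + 1` of the path. A
bending tile keeps their positions. Thus the order of the pipes on the path is the product of the
letters already swept. -/
theorem pipeThrough_frontier {n : ℕ} {D : Finset (ℕ × ℕ)} (hD : InTri n D) {r : ℕ} (hr : r ≤ n)
    (c : ℕ) : ∀ i : Fin n,
      PipeThrough (D : Set (ℕ × ℕ)) i (frontier r c (dreamPerm n (below D r c) i)) := by
  refine frontier_induction (n := n) (Q := fun r c => ∀ i : Fin n,
    PipeThrough (D : Set (ℕ × ℕ)) i (frontier r c (dreamPerm n (below D r c) i))) ?_ ?_ ?_ hr c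
  · intro c i
    rw [below_last hD, dreamPerm_empty, Equiv.Perm.one_apply, frontier, if_pos i.2]
    exact PipeThrough.start
  · intro r _ ih i
    rw [below_row hD, frontier_row (Fin.is_lt _)]
    exact ih i
  · intro r c _ ih i
    have hi := ih i
    by_cases h : (r, c) ∈ D
    · have ha : r + c + 1 < n := by have := hD _ h; simp only at this; omega
      rw [dreamPerm_below_succ h, Equiv.Perm.mul_apply, adj_val ha]
      by_cases h1 : (dreamPerm n (below D r c) i).1 = r + c
      · rw [if_pos h1, frontier_succ_self_succ]
        rw [h1, frontier_self] at hi
        exact PipeThrough.left_cross hi h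
      rw [if_neg h1]
      by_cases h2 : (dreamPerm n (below D r c) i).1 = r + c + 1
      · rw [if_pos h2, frontier_succ_self]
        rw [h2, frontier_self_succ] at hi
        exact PipeThrough.bottom_cross hi h
      rw [if_neg h2, frontier_succ_of_ne h1 h2]
      exact hi
    · rw [below_succ_of_notMem h]
      by_cases h1 : (dreamPerm n (below D r c) i).1 = r + c
      · rw [h1, frontier_succ_self]
        rw [h1, frontier_self] at hi
        exact PipeThrough.left_bend hi h
      by_cases h2 : (dreamPerm n (below D r c) i).1 = r + c + 1
      · rw [h2, frontier_succ_self_succ]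
        rw [h2, frontier_self_succ] at hi
        exact PipeThrough.bottom_bend hi h
      rw [frontier_succ_of_ne h1 h2]
      exact hi

theorem pipeThrough_frontier_iff {n : ℕ} {D : Finset (ℕ × ℕ)} (hD : InTri n D) {r : ℕ}
    (hr : r ≤ n) (c : ℕ) (i j : Fin n) :
    PipeThrough (D : Set (ℕ × ℕ)) i (frontier r c j) ↔ dreamPerm n (below D r c) i = j := by
  have hinv : dreamPerm n (below D r c) ((dreamPerm n (below D r c))⁻¹ j) = j :=
    (dreamPerm n (below D r c)).apply_symm_apply j
  constructor
  · intro h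
    have h1 := pipeThrough_frontier hD hr c ((dreamPerm n (below D r c))⁻¹ j)
    rw [hinv] at h1
    rw [Fin.ext (pipeThrough_unique h h1), hinv]
  · rintro rfl
    exact pipeThrough_frontier hD hr c i

theorem pipeThrough_top_iff {n : ℕ} {D : Finset (ℕ × ℕ)} (hD : InTri n D) (i j : Fin n) :
    PipeThrough (D : Set (ℕ × ℕ)) i (Edge.horiz 0 j) ↔ dreamPerm n D i = j := by
  have h := pipeThrough_frontier_iff hD (Nat.zero_le n) n i j
  rw [below_zero hD] at h
  rw [← h, frontier]
  simp

theorem pipesCrossAt_iff {n : ℕ} {D : Finset (ℕ × ℕ)} (hD : InTri n D) {r c : ℕ} (h : (r, c) ∈ D)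
    (p q : Fin n) : PipesCrossAt (D : Set (ℕ × ℕ)) p q (r, c) ↔
      ((dreamPerm n (below D r c) p).1 = r + c ∧ (dreamPerm n (below D r c) q).1 = r + c + 1) ∨
      ((dreamPerm n (below D r c) q).1 = r + c ∧ (dreamPerm n (below D r c) p).1 = r + c + 1) := by
  have ha : r + c + 1 < n := by have := hD _ h; simp only at this; omega
  have key : ∀ i : Fin n, PipeThrough (D : Set (ℕ × ℕ)) i (Edge.vert r c) ↔
      (dreamPerm n (below D r c) i).1 = r + c := by
    intro i
    have := pipeThrough_frontier_iff hD (r := r) (by omega) c i ⟨r + c, by omega⟩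
    rwa [frontier_self, Fin.ext_iff] at this
  have key' : ∀ i : Fin n, PipeThrough (D : Set (ℕ × ℕ)) i (Edge.horiz (r + 1) c) ↔
      (dreamPerm n (below D r c) i).1 = r + c + 1 := by
    intro i
    have := pipeThrough_frontier_iff hD (r := r) (by omega) c i ⟨r + c + 1, by omega⟩
    rwa [frontier_self_succ, Fin.ext_iff] at this
  simp only [PipesCrossAt, key, key', Finset.mem_coe, h, true_and]

/-- No two of the first `n` pipes cross twice. -/
def CrossOnce (n : ℕ) (D : Set (ℕ × ℕ)) : Prop :=
  ∀ p q : Fin n, p < q → ∀ x y : ℕ × ℕ, PipesCrossAt D p q x → PipesCrossAt D p q y → x = y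

theorem pipesCrossAt_comm {D : Set (ℕ × ℕ)} {p q : ℕ} {x : ℕ × ℕ} :
    PipesCrossAt D p q x ↔ PipesCrossAt D q p x := by
  simp only [PipesCrossAt]
  tauto

theorem isReducedPipeDream_iff {n : ℕ} {D : Set (ℕ × ℕ)} :
    IsReducedPipeDream n D ↔ D ⊆ upperTriangle n ∧ CrossOnce n D := by
  refine and_congr_right fun _ =>
    ⟨fun h p q hpq => h p q p.2 q.2 (by simpa using Fin.val_ne_of_ne hpq.ne), ?_⟩
  intro h p q hp hq hpq x y hx hy
  rcases lt_or_gt_of_ne hpq with hlt | hlt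
  · exact h ⟨p, hp⟩ ⟨q, hq⟩ hlt x y hx hy
  · exact h ⟨q, hq⟩ ⟨p, hp⟩ hlt x y (pipesCrossAt_comm.mp hx) (pipesCrossAt_comm.mp hy)

/-- One step of the comparison of crossings with inversions. -/
theorem crossing_step {n : ℕ} {D : Finset (ℕ × ℕ)} (hD : InTri n D) {r c : ℕ} (h : (r, c) ∈ D)
    (ih : ∀ p q : Fin n, p < q → ((p, q) ∈ invs (dreamPerm n (below D r c)) ↔
      ∃ x ∈ below D r c, PipesCrossAt (D : Set (ℕ × ℕ)) p q x)) {p q : Fin n}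
    (hp : (dreamPerm n (below D r c) p).1 = r + c)
    (hq : (dreamPerm n (below D r c) q).1 = r + c + 1) (hpq : p < q) (s t : Fin n) (hst : s < t) :
    (s, t) ∈ invs (dreamPerm n (below D r (c + 1))) ↔
      ∃ x ∈ below D r (c + 1), PipesCrossAt (D : Set (ℕ × ℕ)) s t x := by
  have ha : r + c + 1 < n := by have := hD _ h; simp only at this; omega
  rw [dreamPerm_below_succ h, invs_adj_mul ha _ hp hq hpq, Finset.mem_insert, ih s t hst,
    below_succ_of_mem h, Finset.union_comm]
  have : PipesCrossAt (D : Set (ℕ × ℕ)) s t (r, c) ↔ (s, t) = (p, q) := by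
    rw [pipesCrossAt_iff hD h, ← hq, ← hp, Prod.mk.injEq]
    simp only [← Fin.ext_iff, EmbeddingLike.apply_eq_iff_eq]
    constructor
    · rintro (h | ⟨rfl, rfl⟩)
      · exact h
      · exact absurd hst (not_lt.mpr hpq.le)
    · exact Or.inl
  rw [← this]
  constructor
  · rintro (h1 | ⟨x, hx, h1⟩)
    · exact ⟨_, Finset.mem_union_right _ (Finset.mem_singleton_self _), h1⟩
    · exact ⟨x, Finset.mem_union_left _ hx, h1⟩
  · rintro ⟨x, hx, h1⟩
    rcases Finset.mem_union.mp hx with hx | hx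
    · exact Or.inr ⟨x, hx, h1⟩
    · rw [Finset.mem_singleton] at hx
      exact Or.inl (hx ▸ h1)

/-- The sweep maintains that the inversions are exactly the pairs of pipes that have crossed. A new
crossing involves a pair not yet inverted, so it adds one to the length. -/
theorem len_eq_card_of_crossOnce {n : ℕ} {D : Finset (ℕ × ℕ)} (hD : InTri n D)
    (h : CrossOnce n (D : Set (ℕ × ℕ))) : len (dreamPerm n D) = D.card := by
  suffices H : ∀ {r : ℕ}, r ≤ n → ∀ c : ℕ,
      len (dreamPerm n (below D r c)) = (below D r c).card ∧
      ∀ p q : Fin n, p < q → ((p, q) ∈ invs (dreamPerm n (below D r c)) ↔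
        ∃ x ∈ below D r c, PipesCrossAt (D : Set (ℕ × ℕ)) p q x) by
    have := (H (Nat.zero_le n) n).1
    rwa [below_zero hD] at this
  intro r hr c
  refine frontier_induction (n := n) (Q := fun r c =>
      len (dreamPerm n (below D r c)) = (below D r c).card ∧
      ∀ p q : Fin n, p < q → ((p, q) ∈ invs (dreamPerm n (below D r c)) ↔
        ∃ x ∈ below D r c, PipesCrossAt (D : Set (ℕ × ℕ)) p q x)) ?_ ?_ ?_ hr c
  · intro c
    rw [below_last hD, dreamPerm_empty, len_one]
    refine ⟨rfl, fun p q hpq => ?_⟩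
    simpa [mem_invs] using fun _ => hpq.le
  · intro r _ ih
    rwa [below_row hD]
  · intro r c _ ih
    by_cases hx : (r, c) ∈ D
    · have ha : r + c + 1 < n := by have := hD _ hx; simp only at this; omega
      obtain ⟨p, hp⟩ : ∃ p, (dreamPerm n (below D r c) p).1 = r + c :=
        ⟨(dreamPerm n (below D r c))⁻¹ ⟨r + c, by omega⟩, by simp⟩
      obtain ⟨q, hq⟩ : ∃ p, (dreamPerm n (below D r c) p).1 = r + c + 1 :=
        ⟨(dreamPerm n (below D r c))⁻¹ ⟨r + c + 1, by omega⟩, by simp⟩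
      have hpq : p < q := by
        rcases lt_trichotomy p q with h1 | rfl | h1
        · exact h1
        · omega
        -- Pipes that arrive in inverted order have crossed before, so this would be their second
        -- crossing.
        · have h2 : (q, p) ∈ invs (dreamPerm n (below D r c)) := by
            rw [mem_invs, Fin.lt_def (a := dreamPerm n _ _), hp, hq]
            exact ⟨h1, by omega⟩
          obtain ⟨x, hx1, hx2⟩ := (ih.2 q p h1).mp h2
          have := h q p h1 x (r, c) hx2 ((pipesCrossAt_iff hD hx q p).mpr (Or.inr ⟨hp, hq⟩))
          subst this
          simp [mem_below] at hx1
      refine ⟨?_, crossing_step hD hx ih.2 hp hq hpq⟩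
      rw [card_below_succ_of_mem hx, ← ih.1, dreamPerm_below_succ hx,
        len_adj_mul_of_lt ha _ hp hq hpq]
    · rwa [below_succ_of_notMem hx]

theorem dreamPerm_eq_mul_below (n : ℕ) (D : Finset (ℕ × ℕ)) (r c : ℕ) :
    dreamPerm n D = dreamPerm n (D \ below D r c) * dreamPerm n (below D r c) := by
  rw [← dreamPerm_union, Finset.sdiff_union_of_subset (s₁ := below D r c) (Finset.filter_subset _ _)]
  intro x hx y hy
  rw [Finset.mem_sdiff, mem_below] at hx
  rw [mem_below] at hy
  refine ⟨?_, ?_⟩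
  · rintro rfl
    exact hx.2 hy
  · rintro ⟨h1, h2, h3⟩
    have hx2 : ¬ (r < x.1 ∨ x.1 = r ∧ x.2 < c) := fun h => hx.2 ⟨hx.1, h⟩
    omega

theorem len_below {n : ℕ} {D : Finset (ℕ × ℕ)} (h : len (dreamPerm n D) = D.card) (r c : ℕ) :
    len (dreamPerm n (below D r c)) = (below D r c).card := by
  refine le_antisymm (len_dreamPerm_le _) ?_
  have h1 := len_dreamPerm_mul_le (D \ below D r c) (dreamPerm n (below D r c))
  rw [← dreamPerm_eq_mul_below, h] at h1
  have h2 : (D \ below D r c).card + (below D r c).card = D.card :=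
    Finset.card_sdiff_add_card_eq_card (Finset.filter_subset _ _)
  omega

/-- Terminal parts of a reduced word are reduced (`len_below`), so each swept crossing must raise
the length. Its two pipes were therefore not inverted, that is, they had not crossed. -/
theorem crossOnce_of_len_eq_card {n : ℕ} {D : Finset (ℕ × ℕ)} (hD : InTri n D)
    (h : len (dreamPerm n D) = D.card) : CrossOnce n (D : Set (ℕ × ℕ)) := by
  suffices H : ∀ {r : ℕ}, r ≤ n → ∀ c : ℕ,
      (∀ p q : Fin n, p < q → ∀ x ∈ below D r c, ∀ y ∈ below D r c,
        PipesCrossAt (D : Set (ℕ × ℕ)) p q x → PipesCrossAt (D : Set (ℕ × ℕ)) p q y → x = y) ∧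
      ∀ p q : Fin n, p < q → ((p, q) ∈ invs (dreamPerm n (below D r c)) ↔
        ∃ x ∈ below D r c, PipesCrossAt (D : Set (ℕ × ℕ)) p q x) by
    have := (H (Nat.zero_le n) n).1
    rw [below_zero hD] at this
    intro p q hpq x y hx hy
    exact this p q hpq x hx.1 y hy.1 hx hy
  intro r hr c
  refine frontier_induction (n := n) (Q := fun r c =>
      (∀ p q : Fin n, p < q → ∀ x ∈ below D r c, ∀ y ∈ below D r c,
        PipesCrossAt (D : Set (ℕ × ℕ)) p q x → PipesCrossAt (D : Set (ℕ × ℕ)) p q y → x = y) ∧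
      ∀ p q : Fin n, p < q → ((p, q) ∈ invs (dreamPerm n (below D r c)) ↔
        ∃ x ∈ below D r c, PipesCrossAt (D : Set (ℕ × ℕ)) p q x)) ?_ ?_ ?_ hr c
  · intro c
    rw [below_last hD, dreamPerm_empty]
    refine ⟨by simp, fun p q hpq => ?_⟩
    simpa [mem_invs] using fun _ => hpq.le
  · intro r _ ih
    rwa [below_row hD]
  · intro r c _ ih
    by_cases hx : (r, c) ∈ D
    · have ha : r + c + 1 < n := by have := hD _ hx; simp only at this; omega
      obtain ⟨p, hp⟩ : ∃ p, (dreamPerm n (below D r c) p).1 = r + c :=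
        ⟨(dreamPerm n (below D r c))⁻¹ ⟨r + c, by omega⟩, by simp⟩
      obtain ⟨q, hq⟩ : ∃ p, (dreamPerm n (below D r c) p).1 = r + c + 1 :=
        ⟨(dreamPerm n (below D r c))⁻¹ ⟨r + c + 1, by omega⟩, by simp⟩
      have hpq : p < q := by
        rcases lt_trichotomy p q with h1 | rfl | h1
        · exact h1
        · omega
        · have h2 := len_adj_mul_of_gt ha _ hp hq h1
          rw [← dreamPerm_below_succ hx, len_below h, len_below h, card_below_succ_of_mem hx] at h2
          omega
      refine ⟨?_, crossing_step hD hx ih.2 hp hq hpq⟩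
      have key : ∀ s t : Fin n, s < t → ∀ y ∈ below D r c,
          PipesCrossAt (D : Set (ℕ × ℕ)) s t y → ¬ PipesCrossAt (D : Set (ℕ × ℕ)) s t (r, c) := by
        intro s t hst y hy h1 h2
        have h3 := (mem_invs.mp ((ih.2 s t hst).mpr ⟨y, hy, h1⟩)).2
        rw [pipesCrossAt_iff hD hx] at h2
        rcases h2 with ⟨h2, h4⟩ | ⟨h2, h4⟩
        · rw [Fin.lt_def, h2, h4] at h3
          omega
        · have e1 : t = p := (dreamPerm n (below D r c)).injective (Fin.ext (h2.trans hp.symm))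
          have e2 : s = q := (dreamPerm n (below D r c)).injective (Fin.ext (h4.trans hq.symm))
          subst e1 e2
          exact absurd hst (not_lt.mpr hpq.le)
      intro s t hst x hx1 y hy1 h1 h2
      rw [below_succ_of_mem hx, Finset.mem_union, Finset.mem_singleton] at hx1 hy1
      rcases hx1 with rfl | hx1 <;> rcases hy1 with rfl | hy1
      · rfl
      · exact absurd h1 (key s t hst y hy1 h2)
      · exact absurd h2 (key s t hst x hx1 h1)
      · exact ih.1 s t hst x hx1 y hy1 h1 h2
    · rwa [below_succ_of_notMem hx]

/-- The bridge from pipes to reduced words; pipes are not needed beyond this equivalence. -/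
theorem mem_PD_iff {n : ℕ} {w : Equiv.Perm (Fin n)} {D : Finset (ℕ × ℕ)} :
    (D : Set (ℕ × ℕ)) ∈ PD w ↔ InTri n D ∧ dreamPerm n D = w ∧ len w = D.card := by
  rw [PD, Set.mem_ofPred_eq, isReducedPipeDream_iff, ← inTri_iff, and_assoc]
  refine and_congr_right fun hD => ?_
  have h1 : (∀ i : Fin n, PipeThrough (D : Set (ℕ × ℕ)) i (Edge.horiz 0 (w i))) ↔
      dreamPerm n D = w := by
    simp only [pipeThrough_top_iff hD, Equiv.ext_iff]
  rw [h1]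
  constructor
  · rintro ⟨h2, rfl⟩
    exact ⟨rfl, len_eq_card_of_crossOnce hD h2⟩
  · rintro ⟨rfl, h2⟩
    exact ⟨crossOnce_of_len_eq_card hD h2, rfl⟩

theorem finite_upperTriangle (n : ℕ) : (upperTriangle n).Finite := by
  refine ((Set.finite_Iio n).prod (Set.finite_Iio n)).subset fun x hx => ?_
  have : x.1 + x.2 + 2 ≤ n := hx
  simp only [Set.mem_prod, Set.mem_Iio]
  omega

/-! ### Ladder moves and permutations -/

theorem dreamPerm_union_of_lt (n : ℕ) {D E : Finset (ℕ × ℕ)}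
    (h : ∀ x ∈ D, ∀ y ∈ E, y.1 ≤ x.1 → y.2 < x.2) :
    dreamPerm n (D ∪ E) = dreamPerm n D * dreamPerm n E := by
  refine dreamPerm_union n fun x hx y hy => ⟨?_, ?_⟩
  · rintro rfl
    exact lt_irrefl _ (h x hx x hy le_rfl)
  · rintro ⟨-, h2, h3⟩
    exact absurd (h x hx y hy h2) (not_lt.mpr h3)

/-- A cell whose transposition commutes with those of all cells northeast of it can be moved to the
front. -/
theorem dreamPerm_eq_adj_mul_erase (n : ℕ) {D : Finset (ℕ × ℕ)} {x : ℕ × ℕ} (hx : x ∈ D)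
    (h : ∀ y ∈ D, y.1 ≤ x.1 → x.2 ≤ y.2 → y ≠ x →
      x.1 + x.2 + 2 ≤ y.1 + y.2 ∨ y.1 + y.2 + 2 ≤ x.1 + x.2) :
    dreamPerm n D = adj n (x.1 + x.2) * dreamPerm n (D.erase x) := by
  set A := D.filter fun y => y.1 ≤ x.1 ∧ x.2 ≤ y.2 ∧ y ≠ x with hA
  set B := D.filter fun y => ¬ (y.1 ≤ x.1 ∧ x.2 ≤ y.2) with hB
  have e1 : D = A ∪ ({x} ∪ B) := by
    ext y
    simp only [hA, hB, Finset.mem_union, Finset.mem_filter, Finset.mem_singleton]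
    by_cases hy : y = x
    · subst hy; simp [hx]
    · simp only [hy]; tauto
  have e2 : D.erase x = A ∪ B := by
    ext y
    simp only [hA, hB, Finset.mem_union, Finset.mem_filter, Finset.mem_erase]
    by_cases hy : y = x
    · subst hy; simp
    · simp only [hy, ne_eq, not_false_eq_true]; tauto
  rw [e2]
  nth_rw 1 [e1]
  rw [dreamPerm_union_of_lt, dreamPerm_union_of_lt, dreamPerm_union_of_lt, dreamPerm_singleton,
    ← mul_assoc, ← mul_assoc, (commute_dreamPerm (D := A) (n := n) _).eq]
  · intro y hy
    simp only [hA, Finset.mem_filter] at hy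
    exact h y hy.1 hy.2.1 hy.2.2.1 hy.2.2.2
  · intro u hu v hv
    simp only [hA, hB, Finset.mem_filter] at hu hv
    intro hvu
    omega
  · intro u hu v hv
    simp only [hB, Finset.mem_filter, Finset.mem_singleton] at hu hv
    subst hu
    omega
  · intro u hu v hv
    simp only [hA, hB, Finset.mem_filter, Finset.mem_union, Finset.mem_singleton] at hu hv
    intro hvu
    rcases hv with rfl | hv
    · rcases hu with ⟨-, h1, h2, h3⟩
      by_contra hc
      exact h3 (Prod.ext (by omega) (by omega))
    · omega

/-- The cells in the columns `k` and `k + 1` and strictly between the rows `i` and `j`. -/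
def ladderBlock (i j k : ℕ) : Finset (ℕ × ℕ) := Finset.Ioo i j ×ˢ {k, k + 1}

theorem mem_ladderBlock {i j k : ℕ} {x : ℕ × ℕ} :
    x ∈ ladderBlock i j k ↔ i < x.1 ∧ x.1 < j ∧ (x.2 = k ∨ x.2 = k + 1) := by
  simp [ladderBlock, and_assoc]

/-- Each full row of the block contributes two consecutive letters, and one braid relation carries
the extra letter past them with its index lowered by one. -/
theorem ladderBlock_mul_adj {n i j k : ℕ} (hij : i < j) (hj : j + k + 1 < n) :
    dreamPerm n (ladderBlock i j k) * adj n (j + k) =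
      adj n (i + k + 1) * dreamPerm n (ladderBlock i j k) := by
  induction j, hij using Nat.le_induction with
  | base =>
    have : ladderBlock i (i + 1) k = ∅ := by
      ext x
      simp only [mem_ladderBlock, Finset.notMem_empty, iff_false]
      omega
    rw [this, dreamPerm_empty, one_mul, mul_one]
    congr 1
    omega
  | succ j hij ih =>
    have e : ladderBlock i (j + 1) k = ladderBlock i j k ∪ ({(j, k + 1)} ∪ {(j, k)}) := by
      ext ⟨a, b⟩
      simp only [mem_ladderBlock, Finset.mem_union, Finset.mem_singleton, Prod.mk.injEq]
      omega
    rw [e, dreamPerm_union_of_lt, dreamPerm_union_of_lt, dreamPerm_singleton, dreamPerm_singleton]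
    · have e1 : j + (k + 1) = j + k + 1 := by omega
      have e2 : j + 1 + k = j + k + 1 := by omega
      simp only [e1, e2]
      rw [mul_assoc, ← adj_braid (by omega), ← mul_assoc, ih (by omega), mul_assoc]
    · simp
    · intro x hx y hy
      simp only [mem_ladderBlock, Finset.mem_union, Finset.mem_singleton] at hx hy
      rcases hy with rfl | rfl <;> simp only <;> omega

/-- The cells of `D` before the ladder in the reading order. -/
def ladderUp (i j k : ℕ) (D : Finset (ℕ × ℕ)) : Finset (ℕ × ℕ) :=
  D.filter fun x => x.1 < i ∨ x.1 ≤ j ∧ k + 1 < x.2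

/-- The cells of `D` after the ladder in the reading order. -/
def ladderDown (i j k : ℕ) (D : Finset (ℕ × ℕ)) : Finset (ℕ × ℕ) :=
  D.filter fun x => j < x.1 ∨ i ≤ x.1 ∧ x.2 < k

/-- The cells of `D` in row `i` and the columns `k` and `k + 1`. -/
def ladderRung (i k : ℕ) (D : Finset (ℕ × ℕ)) : Finset (ℕ × ℕ) :=
  D.filter fun x => x.1 = i ∧ (x.2 = k ∨ x.2 = k + 1)

/-- The five pieces are consecutive in a reading: no cell of a later piece is weakly northeast of a
cell of an earlier one. A move affects only the two rungs. -/
theorem dreamPerm_ladder (n : ℕ) {i j k : ℕ} {D : Finset (ℕ × ℕ)} (hij : i < j)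
    (hX : ladderBlock i j k ⊆ D) :
    dreamPerm n D = dreamPerm n (ladderUp i j k D) * (dreamPerm n (ladderRung i k D) *
      (dreamPerm n (ladderBlock i j k) *
        (dreamPerm n (ladderRung j k D) * dreamPerm n (ladderDown i j k D)))) := by
  have e : D = ladderUp i j k D ∪ (ladderRung i k D ∪ (ladderBlock i j k ∪
      (ladderRung j k D ∪ ladderDown i j k D))) := by
    ext x
    have := @hX x
    simp only [mem_ladderBlock, ladderUp, ladderDown, ladderRung, Finset.mem_union,
      Finset.mem_filter] at this ⊢
    constructor
    · intro hx
      simp only [hx, true_and]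
      omega
    · rintro (h | h | h | h | h)
      · exact h.1
      · exact h.1
      · exact this h
      · exact h.1
      · exact h.1
  conv_lhs => rw [e]
  rw [dreamPerm_union_of_lt, dreamPerm_union_of_lt, dreamPerm_union_of_lt, dreamPerm_union_of_lt]
  all_goals
    intro x hx y hy
    simp only [mem_ladderBlock, ladderUp, ladderDown, ladderRung, Finset.mem_union,
      Finset.mem_filter] at hx hy
    omega

theorem ladderUp_congr {i j k : ℕ} {D E : Finset (ℕ × ℕ)} (hij : i < j)
    (h : ∀ x ∉ ladderBlock i j k, (x.1 = i ∨ x.1 = j) ∧ (x.2 = k ∨ x.2 = k + 1) ∨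
      (x ∈ D ↔ x ∈ E)) : ladderUp i j k D = ladderUp i j k E := by
  ext x
  have := h x
  simp only [mem_ladderBlock] at this
  simp only [ladderUp, Finset.mem_filter, and_congr_left_iff]
  intro hx
  exact (this (by omega)).resolve_left (by omega)

theorem ladderDown_congr {i j k : ℕ} {D E : Finset (ℕ × ℕ)} (hij : i < j)
    (h : ∀ x ∉ ladderBlock i j k, (x.1 = i ∨ x.1 = j) ∧ (x.2 = k ∨ x.2 = k + 1) ∨
      (x ∈ D ↔ x ∈ E)) : ladderDown i j k D = ladderDown i j k E := by
  ext x
  have := h x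
  simp only [mem_ladderBlock] at this
  simp only [ladderDown, Finset.mem_filter, and_congr_left_iff]
  intro hx
  exact (this (by omega)).resolve_left (by omega)

theorem ladderRung_eq_empty {i k : ℕ} {D : Finset (ℕ × ℕ)} (h : (i, k) ∉ D)
    (h' : (i, k + 1) ∉ D) : ladderRung i k D = ∅ := by
  ext ⟨a, b⟩
  simp only [ladderRung, Finset.mem_filter, Finset.notMem_empty, iff_false]
  rintro ⟨h1, rfl, rfl | rfl⟩ <;> contradiction

theorem ladderRung_eq_left {i k : ℕ} {D : Finset (ℕ × ℕ)} (h : (i, k) ∈ D)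
    (h' : (i, k + 1) ∉ D) : ladderRung i k D = {(i, k)} := by
  ext ⟨a, b⟩
  simp only [ladderRung, Finset.mem_filter, Finset.mem_singleton, Prod.mk.injEq]
  constructor
  · rintro ⟨h1, rfl, rfl | rfl⟩
    · exact ⟨rfl, rfl⟩
    · contradiction
  · rintro ⟨rfl, rfl⟩
    exact ⟨h, rfl, Or.inl rfl⟩

theorem ladderRung_eq_right {i k : ℕ} {D : Finset (ℕ × ℕ)} (h : (i, k) ∉ D)
    (h' : (i, k + 1) ∈ D) : ladderRung i k D = {(i, k + 1)} := by
  ext ⟨a, b⟩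
  simp only [ladderRung, Finset.mem_filter, Finset.mem_singleton, Prod.mk.injEq]
  constructor
  · rintro ⟨h1, rfl, rfl | rfl⟩
    · contradiction
    · exact ⟨rfl, rfl⟩
  · rintro ⟨rfl, rfl⟩
    exact ⟨h', rfl, Or.inr rfl⟩

/-- A ladder move does not change the permutation. -/
theorem dreamPerm_ladder_move {n i j k : ℕ} {D : Finset (ℕ × ℕ)} (hij : i < j)
    (hn : j + k + 1 < n) (hX : ladderBlock i j k ⊆ D) (h1 : (j, k) ∈ D) (h2 : (i, k) ∉ D)
    (h3 : (i, k + 1) ∉ D) (h4 : (j, k + 1) ∉ D) :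
    dreamPerm n (insert (i, k + 1) (D.erase (j, k))) = dreamPerm n D := by
  have hmem : ∀ x, x ∈ insert (i, k + 1) (D.erase (j, k)) ↔ x = (i, k + 1) ∨ x ≠ (j, k) ∧ x ∈ D := by
    simp
  have hX' : ladderBlock i j k ⊆ insert (i, k + 1) (D.erase (j, k)) := by
    intro x hx
    rw [hmem]
    refine Or.inr ⟨?_, hX hx⟩
    rintro rfl
    simp [mem_ladderBlock] at hx
  have hc : ∀ x ∉ ladderBlock i j k, (x.1 = i ∨ x.1 = j) ∧ (x.2 = k ∨ x.2 = k + 1) ∨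
      (x ∈ insert (i, k + 1) (D.erase (j, k)) ↔ x ∈ D) := by
    rintro ⟨a, b⟩ -
    rw [hmem]
    by_cases e1 : (a, b) = (i, k + 1)
    · rw [Prod.mk.injEq] at e1
      exact Or.inl ⟨Or.inl e1.1, Or.inr e1.2⟩
    by_cases e2 : (a, b) = (j, k)
    · rw [Prod.mk.injEq] at e2
      exact Or.inl ⟨Or.inr e2.1, Or.inl e2.2⟩
    simp [e1, e2]
  have hji : j ≠ i := hij.ne'
  rw [dreamPerm_ladder n hij hX, dreamPerm_ladder n hij hX', ladderUp_congr hij hc,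
    ladderDown_congr hij hc, ladderRung_eq_empty h2 h3, ladderRung_eq_left h1 h4,
    ladderRung_eq_right (by simp [h2]) (by simp), ladderRung_eq_empty (by simp [hji])
    (by simp [h4, hji]), dreamPerm_empty, dreamPerm_singleton, dreamPerm_singleton, one_mul,
    one_mul, ← mul_assoc (dreamPerm n (ladderBlock i j k)), ladderBlock_mul_adj hij hn, mul_assoc]
  simp only [add_assoc]

/-- If two cells form the two ends of a ladder, then they cancel. -/
theorem dreamPerm_ladder_cancel {n i j k : ℕ} {D : Finset (ℕ × ℕ)} (hij : i < j)
    (hn : j + k + 1 < n) (hX : ladderBlock i j k ⊆ D) (h1 : (j, k) ∈ D) (h2 : (i, k) ∉ D)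
    (h3 : (i, k + 1) ∈ D) (h4 : (j, k + 1) ∉ D) :
    dreamPerm n ((D.erase (j, k)).erase (i, k + 1)) = dreamPerm n D := by
  have hmem : ∀ x, x ∈ (D.erase (j, k)).erase (i, k + 1) ↔
      x ≠ (i, k + 1) ∧ x ≠ (j, k) ∧ x ∈ D := by
    simp
  have hX' : ladderBlock i j k ⊆ (D.erase (j, k)).erase (i, k + 1) := by
    intro x hx
    rw [hmem]
    refine ⟨?_, ?_, hX hx⟩
    all_goals
      rintro rfl
      simp [mem_ladderBlock] at hx
  have hc : ∀ x ∉ ladderBlock i j k, (x.1 = i ∨ x.1 = j) ∧ (x.2 = k ∨ x.2 = k + 1) ∨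
      (x ∈ (D.erase (j, k)).erase (i, k + 1) ↔ x ∈ D) := by
    rintro ⟨a, b⟩ -
    rw [hmem]
    by_cases e1 : (a, b) = (i, k + 1)
    · rw [Prod.mk.injEq] at e1
      exact Or.inl ⟨Or.inl e1.1, Or.inr e1.2⟩
    by_cases e2 : (a, b) = (j, k)
    · rw [Prod.mk.injEq] at e2
      exact Or.inl ⟨Or.inr e2.1, Or.inl e2.2⟩
    simp [e1, e2]
  rw [dreamPerm_ladder n hij hX, dreamPerm_ladder n hij hX', ladderUp_congr hij hc,
    ladderDown_congr hij hc, ladderRung_eq_right h2 h3, ladderRung_eq_left h1 h4,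
    ladderRung_eq_empty (by simp [h2]) (by simp), ladderRung_eq_empty (by simp)
    (by simp [h4]), dreamPerm_empty, dreamPerm_singleton, dreamPerm_singleton, one_mul,
    one_mul, ← mul_assoc (dreamPerm n (ladderBlock i j k)) (adj n _), ladderBlock_mul_adj hij hn,
    mul_assoc, ← mul_assoc (adj n _) (adj n _)]
  simp only [← add_assoc]
  rw [adj_mul_self, one_mul]

/-! ### The base involution -/

theorem fpfBase_val {n : ℕ} (hn : Even n) (i : Fin n) :
    (fpfBase n i).1 = if i.1 % 2 = 1 then i.1 - 1 else i.1 + 1 := by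
  have hi := i.2
  have h : fpfBase n i = baseFun n i := rfl
  rw [h, baseFun]
  rw [Nat.even_iff] at hn
  split_ifs
  · rfl
  · rfl
  · omega

/-- In the indexing from `0`, an even `a` makes `(a, a + 1)` a cycle of the base involution. -/
theorem adj_conj_fpfBase {n a : ℕ} (hn : Even n) (ha : a % 2 = 0) :
    adj n a * fpfBase n * adj n a = fpfBase n := by
  by_cases h : a + 1 < n
  · refine Equiv.ext fun i => Fin.ext ?_
    simp only [Equiv.Perm.mul_apply, adj_val h, fpfBase_val hn]
    split_ifs <;> omega
  · rw [adj_of_le (not_lt.mp h), one_mul, mul_one]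

/-- With `b = a - 1`, conjugation by `s_a` turns the cycles on `b, …, b + 3` into `(b, b+2)(b+1,
b+3)`. Exchanging either `b, b+1` or `b+2, b+3` gives `(b, b+3)(b+1, b+2)`. -/
theorem adj_conj_fpfBase_eq {n a : ℕ} (hn : Even n) (ha : a % 2 = 1) (han : a + 2 < n) :
    adj n (a - 1) * (adj n a * fpfBase n * adj n a) * adj n (a - 1) =
      adj n (a + 1) * (adj n a * fpfBase n * adj n a) * adj n (a + 1) := by
  obtain ⟨b, rfl⟩ : ∃ b, a = b + 1 := ⟨a - 1, by omega⟩
  have h0 : b + 1 < n := by omega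
  have h1 : b + 1 + 1 < n := by omega
  have h2 : b + 1 + 1 + 1 < n := by omega
  have hG : ∀ i, (adj n (b + 1) * fpfBase n * adj n (b + 1)) i =
      if i.1 = b then b + 2 else if i.1 = b + 1 then b + 3 else if i.1 = b + 2 then b
      else if i.1 = b + 3 then b + 1 else if i.1 % 2 = 1 then i.1 - 1 else i.1 + 1 := by
    intro i
    simp only [Equiv.Perm.mul_apply, adj_val h1, fpfBase_val hn]
    split_ifs <;> omega
  generalize adj n (b + 1) * fpfBase n * adj n (b + 1) = G at hG ⊢
  rw [Nat.add_sub_cancel]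
  have e1 : ∀ i, (adj n b * G * adj n b) i =
      if i.1 = b then b + 3 else if i.1 = b + 1 then b + 2 else if i.1 = b + 2 then b + 1
      else if i.1 = b + 3 then b else if i.1 % 2 = 1 then i.1 - 1 else i.1 + 1 := by
    intro i
    rw [Equiv.Perm.mul_apply, Equiv.Perm.mul_apply, adj_val h0]
    have A := adj_val h0 i
    generalize adj n b i = j at A ⊢
    have B := hG j
    generalize G j = l at B ⊢
    split_ifs at A <;> split_ifs at B <;> first | (exfalso; omega) | (split_ifs <;> omega)
  have e2 : ∀ i, (adj n (b + 1 + 1) * G * adj n (b + 1 + 1)) i =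
      if i.1 = b then b + 3 else if i.1 = b + 1 then b + 2 else if i.1 = b + 2 then b + 1
      else if i.1 = b + 3 then b else if i.1 % 2 = 1 then i.1 - 1 else i.1 + 1 := by
    intro i
    rw [Equiv.Perm.mul_apply, Equiv.Perm.mul_apply, adj_val h2]
    have A := adj_val h2 i
    generalize adj n (b + 1 + 1) i = j at A ⊢
    have B := hG j
    generalize G j = l at B ⊢
    split_ifs at A <;> split_ifs at B <;> first | (exfalso; omega) | (split_ifs <;> omega)
  exact Equiv.ext fun i => Fin.ext ((e1 i).trans (e2 i).symm)

/-- `z = v⁻¹ (1,2)(3,4)⋯(n-1,n) v`. -/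
def Conj {n : ℕ} (z v : Equiv.Perm (Fin n)) : Prop := z = v⁻¹ * fpfBase n * v

theorem conj_adj_mul {n a : ℕ} (hn : Even n) (ha : a % 2 = 0) {z v : Equiv.Perm (Fin n)} :
    Conj z (adj n a * v) ↔ Conj z v := by
  have e : (adj n a * v)⁻¹ * fpfBase n * (adj n a * v) =
      v⁻¹ * (adj n a * fpfBase n * adj n a) * v := by
    rw [mul_inv_rev, adj_inv]
    simp only [mul_assoc]
  rw [Conj, Conj, e, adj_conj_fpfBase hn ha]

theorem conj_adj_mul_adj_mul {n a : ℕ} (hn : Even n) (ha : a % 2 = 1) (han : a + 2 < n)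
    {z v : Equiv.Perm (Fin n)} :
    Conj z (adj n a * (adj n (a - 1) * v)) ↔ Conj z (adj n a * (adj n (a + 1) * v)) := by
  have e : ∀ b, (adj n a * (adj n b * v))⁻¹ * fpfBase n * (adj n a * (adj n b * v)) =
      v⁻¹ * (adj n b * (adj n a * fpfBase n * adj n a) * adj n b) * v := by
    intro b
    rw [mul_inv_rev, mul_inv_rev, adj_inv, adj_inv]
    simp only [mul_assoc]
  rw [Conj, Conj, e, e, adj_conj_fpfBase_eq hn ha han]

/-! ### Reduced pipe dreams of atoms -/

/-- `D` is a reduced pipe dream of an fpf-atom of `z`. -/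
structure IsFpfDream {n : ℕ} (z : Equiv.Perm (Fin n)) (D : Finset (ℕ × ℕ)) : Prop where
  inTri : InTri n D
  conj : Conj z (dreamPerm n D)
  card_le : ∀ v, Conj z v → D.card ≤ len v

theorem IsFpfDream.len_eq {n : ℕ} {z : Equiv.Perm (Fin n)} {D : Finset (ℕ × ℕ)}
    (h : IsFpfDream z D) : len (dreamPerm n D) = D.card :=
  le_antisymm (len_dreamPerm_le D) (h.card_le _ h.conj)

theorem IsFpfDream.isFpfAtom {n : ℕ} {z : Equiv.Perm (Fin n)} {D : Finset (ℕ × ℕ)}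
    (h : IsFpfDream z D) : IsFpfAtom z (dreamPerm n D) :=
  ⟨h.conj, fun v hv => h.len_eq.le.trans (h.card_le v hv)⟩

theorem coe_mem_FDPlus_iff {n : ℕ} {z : Equiv.Perm (Fin n)} {D : Finset (ℕ × ℕ)} :
    (D : Set (ℕ × ℕ)) ∈ FDPlus z ↔ IsFpfDream z D := by
  constructor
  · rintro ⟨w, hw, hD⟩
    rw [mem_PD_iff] at hD
    obtain ⟨h1, rfl, h2⟩ := hD
    exact ⟨h1, hw.1, fun v hv => h2 ▸ hw.2 v hv⟩
  · intro h
    exact ⟨dreamPerm n D, h.isFpfAtom, mem_PD_iff.mpr ⟨h.inTri, rfl, h.len_eq⟩⟩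

theorem finite_of_mem_FDPlus {n : ℕ} {z : Equiv.Perm (Fin n)} {D : Set (ℕ × ℕ)}
    (h : D ∈ FDPlus z) : D.Finite := by
  obtain ⟨w, -, hD⟩ := h
  exact (finite_upperTriangle n).subset hD.1.1

/-- A transposition that can be moved to the front of a word of an atom does not centralize the
base involution, hence has odd index. -/
theorem IsFpfDream.odd_of_first {n : ℕ} {z : Equiv.Perm (Fin n)} {D : Finset (ℕ × ℕ)} (hn : Even n)
    (h : IsFpfDream z D) {x : ℕ × ℕ} (hx : x ∈ D)
    (hc : ∀ y ∈ D, y.1 ≤ x.1 → x.2 ≤ y.2 → y ≠ x →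
      x.1 + x.2 + 2 ≤ y.1 + y.2 ∨ y.1 + y.2 + 2 ≤ x.1 + x.2) : (x.1 + x.2) % 2 = 1 := by
  by_contra ho
  have h1 := h.conj
  rw [dreamPerm_eq_adj_mul_erase n hx hc, conj_adj_mul hn (by omega)] at h1
  have h2 := h.card_le _ h1
  have h3 := len_dreamPerm_le (n := n) (D.erase x)
  have h4 := Finset.card_erase_add_one hx
  omega

/-! ### Invariance under moves -/

theorem IsFpfDream.congr {n : ℕ} {z : Equiv.Perm (Fin n)} {D E : Finset (ℕ × ℕ)}
    (h : IsFpfDream z D) (hE : InTri n E) (hc : E.card = D.card)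
    (hz : Conj z (dreamPerm n D) → Conj z (dreamPerm n E)) : IsFpfDream z E :=
  ⟨hE, hz h.conj, fun v hv => hc ▸ h.card_le v hv⟩

theorem ladderMove_coe {D E : Finset (ℕ × ℕ)} (h : LadderMove (D : Set (ℕ × ℕ)) E) :
    ∃ i j k : ℕ, i < j ∧ ladderBlock i j k ⊆ D ∧ (j, k) ∈ D ∧ (i, k) ∉ D ∧ (i, k + 1) ∉ D ∧
      (j, k + 1) ∉ D ∧ E = insert (i, k + 1) (D.erase (j, k)) := by
  obtain ⟨i, j, k, h1, h2, h3, h4, h5, h6, h7⟩ := h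
  refine ⟨i, j, k, h1, ?_, h3, h4, h5, h6, ?_⟩
  · rintro ⟨a, b⟩ hx
    rw [mem_ladderBlock] at hx
    obtain ⟨ha, hb, e | e⟩ := hx <;> simp only at ha hb e <;> subst e
    · exact (h2 a ha hb).1
    · exact (h2 a ha hb).2
  · rw [← Finset.coe_inj, h7]
    ext x
    simp only [Set.mem_union, Set.mem_sdiff, Set.mem_singleton_iff, Finset.coe_insert,
      Finset.coe_erase, Set.mem_insert_iff]
    tauto

theorem isFpfDream_iff_of_ladderMove {n : ℕ} {z : Equiv.Perm (Fin n)} {D E : Finset (ℕ × ℕ)}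
    (h : LadderMove (D : Set (ℕ × ℕ)) E) : IsFpfDream z D ↔ IsFpfDream z E := by
  obtain ⟨i, j, k, h1, h2, h3, h4, h5, h6, rfl⟩ := ladderMove_coe h
  have hc : (insert (i, k + 1) (D.erase (j, k))).card = D.card := by
    rw [Finset.card_insert_of_notMem (by simp [h5]), Finset.card_erase_add_one h3]
  constructor
  · intro hD
    have hjk := hD.inTri _ h3
    refine hD.congr ?_ hc fun hz => ?_
    · intro x hx
      rw [Finset.mem_insert, Finset.mem_erase] at hx
      rcases hx with rfl | hx
      · simp only at hjk ⊢; omega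
      · exact hD.inTri _ hx.2
    · rwa [dreamPerm_ladder_move h1 (by simp only at hjk; omega) h2 h3 h4 h5 h6]
  · intro hE
    -- The cell `(j - 1, k + 1)` lies on the antidiagonal of `(j, k)` and belongs to `E`, either as
    -- the new cell or as a block cell.
    have hjk : j + k + 2 ≤ n := by
      have h8 : (j - 1, k + 1) ∈ insert (i, k + 1) (D.erase (j, k)) := by
        by_cases e : j = i + 1
        · subst e; simp
        · refine Finset.mem_insert_of_mem (Finset.mem_erase.mpr ⟨by simp, h2 ?_⟩)
          simp only [mem_ladderBlock, or_true, and_true]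
          omega
      have := hE.inTri _ h8
      simp only at this
      omega
    refine hE.congr ?_ hc.symm fun hz => ?_
    · intro x hx
      by_cases e : x = (j, k)
      · rw [e]; exact hjk
      · exact hE.inTri _ (Finset.mem_insert_of_mem (Finset.mem_erase.mpr ⟨e, hx⟩))
    · rwa [dreamPerm_ladder_move h1 (by omega) h2 h3 h4 h5 h6] at hz

theorem fpfLadderMove_coe {D E : Finset (ℕ × ℕ)} (h : FpfLadderMove (D : Set (ℕ × ℕ)) E) :
    ∃ i j k : ℕ, i < j ∧ 1 ≤ k ∧ ladderBlock i j k ⊆ D ∧ (i, k) ∈ D ∧ (j, k) ∈ D ∧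
      (i, k - 1) ∉ D ∧ (i, k + 1) ∉ D ∧ (i, k + 2) ∉ D ∧
      (j, k + 1) ∉ D ∧ E = insert (i, k - 1) (D.erase (j, k)) ∧
      ∀ a b : ℕ, a < i → i + k ≤ a + b + 2 → a + b ≤ i + k + 2 → (a, b) ∉ D := by
  obtain ⟨i, j, k, h1, h1', h2, h3, h3', h4, h5, h6, h6', h7, h8⟩ := h
  refine ⟨i, j, k, h1, h1', ?_, h3, h3', h4, h5, h6, h6', ?_, h8⟩
  · rintro ⟨a, b⟩ hx
    rw [mem_ladderBlock] at hx
    obtain ⟨ha, hb, e | e⟩ := hx <;> simp only at ha hb e <;> subst e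
    · exact (h2 a ha hb).1
    · exact (h2 a ha hb).2
  · rw [← Finset.coe_inj, h7]
    ext x
    simp only [Set.mem_union, Set.mem_sdiff, Set.mem_singleton_iff, Finset.coe_insert,
      Finset.coe_erase, Set.mem_insert_iff]
    tauto

/-- If the top rung of a ladder starts with the cells `(i, k - 1)`, `(i, k)`, then these can be
moved to the front. -/
theorem dreamPerm_two_first (n : ℕ) {i k : ℕ} (hk : 1 ≤ k) {D : Finset (ℕ × ℕ)}
    (h1 : (i, k) ∈ D) (h2 : (i, k - 1) ∈ D) (h3 : (i, k + 1) ∉ D) (h4 : (i, k + 2) ∉ D)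
    (h5 : ∀ a b : ℕ, a < i → i + k ≤ a + b + 2 → a + b ≤ i + k + 2 → (a, b) ∉ D) :
    dreamPerm n D = adj n (i + k) * (adj n (i + k - 1) *
      dreamPerm n ((D.erase (i, k)).erase (i, k - 1))) := by
  have key : ∀ a b : ℕ, (a, b) ∈ D → a ≤ i → k - 1 ≤ b → ¬ (a = i ∧ b = k) →
      ¬ (a = i ∧ b = k - 1) → i + k + 3 ≤ a + b ∨ a + b + 3 ≤ i + k := by
    intro a b hab ha hb e1 e2
    by_contra hc
    rcases Nat.lt_or_eq_of_le ha with h | rfl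
    · exact h5 a b h (by omega) (by omega) hab
    · have : b = k + 1 ∨ b = k + 2 := by omega
      rcases this with rfl | rfl <;> contradiction
  rw [dreamPerm_eq_adj_mul_erase n h1, dreamPerm_eq_adj_mul_erase n (x := (i, k - 1))
    (D := D.erase (i, k))]
  · simp only [Nat.add_sub_assoc hk]
  · refine Finset.mem_erase.mpr ⟨?_, h2⟩
    rw [ne_eq, Prod.mk.injEq]
    omega
  · rintro ⟨a, b⟩ hx ha hb e
    rw [Finset.mem_erase, ne_eq, Prod.mk.injEq] at hx
    rw [ne_eq, Prod.mk.injEq] at e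
    simp only at ha hb ⊢
    have := key a b hx.2 ha hb hx.1 e
    omega
  · rintro ⟨a, b⟩ hx ha hb e
    rw [ne_eq, Prod.mk.injEq] at e
    simp only at ha hb ⊢
    have := key a b hx ha (by omega) e (by omega)
    omega

/-- The empty antidiagonals to the northeast let the letter of `(i, k)` come first in the word of an
atom. -/
theorem odd_of_top_rung {n : ℕ} {z : Equiv.Perm (Fin n)} (hn : Even n) {i k : ℕ}
    {D : Finset (ℕ × ℕ)} (hD : IsFpfDream z D)
    (h1 : (i, k) ∈ D) (h3 : (i, k + 1) ∉ D) (h4 : (i, k + 2) ∉ D)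
    (h5 : ∀ a b : ℕ, a < i → i + k ≤ a + b + 2 → a + b ≤ i + k + 2 → (a, b) ∉ D) :
    (i + k) % 2 = 1 := by
  refine hD.odd_of_first hn (x := (i, k)) h1 ?_
  rintro ⟨a, b⟩ hx ha hb e
  rw [ne_eq, Prod.mk.injEq] at e
  simp only at ha hb ⊢
  by_contra hc
  rcases Nat.lt_or_eq_of_le ha with h | rfl
  · exact h5 a b h (by omega) (by omega) hx
  · have : b = k + 1 ∨ b = k + 2 := by omega
    rcases this with rfl | rfl <;> contradiction

/-- In the situation of an fpf ladder move, the bottom cell `(j, k)` can be moved to the front, past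
`(i, k)`. -/
theorem dreamPerm_fpf_ladder {n i j k : ℕ} {D : Finset (ℕ × ℕ)} (hij : i < j) (hn : j + k + 1 < n)
    (hX : ladderBlock i j k ⊆ D) (h1 : (i, k) ∉ D) (h2 : (i, k + 1) ∉ D) (h3 : (i, k + 2) ∉ D)
    (h4 : (j, k) ∈ D) (h5 : (j, k + 1) ∉ D)
    (h6 : ∀ a b : ℕ, a < i → i + k ≤ a + b + 2 → a + b ≤ i + k + 2 → (a, b) ∉ D) :
    dreamPerm n D = adj n (i + k + 1) * dreamPerm n (D.erase (j, k)) := by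
  rw [← dreamPerm_ladder_move hij hn hX h4 h1 h2 h5,
    dreamPerm_eq_adj_mul_erase n (x := (i, k + 1)) (Finset.mem_insert_self _ _),
    Finset.erase_insert (by simp [h2])]
  · simp only [add_assoc]
  · rintro ⟨a, b⟩ hx ha hb e
    rw [Finset.mem_insert, Finset.mem_erase] at hx
    have hx := (hx.resolve_left e).2
    rw [ne_eq, Prod.mk.injEq] at e
    simp only at ha hb ⊢
    by_contra hc
    rcases Nat.lt_or_eq_of_le ha with h | rfl
    · exact h6 a b h (by omega) (by omega) hx
    · obtain rfl : b = k + 2 := by omega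
      contradiction

/-- Put `a = i + k`. In `D`, the cell `(i, k)` moves to the front, and after its removal the ladder
carries `(j, k)` up to the letter `s_{a+1}`. In `E`, the two top cells give `s_a s_{a-1}`. The
remaining cells are the same. -/
theorem isFpfDream_iff_of_fpfLadderMove {n : ℕ} (hn : Even n) {z : Equiv.Perm (Fin n)}
    {D E : Finset (ℕ × ℕ)} (h : FpfLadderMove (D : Set (ℕ × ℕ)) E) :
    IsFpfDream z D ↔ IsFpfDream z E := by
  obtain ⟨i, j, k, h1, hk, hX, h2, h3, h4, h5, h6, h7, rfl, h8⟩ := fpfLadderMove_coe h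
  have hk1 : k ≠ k - 1 := by omega
  have hji : j ≠ i := h1.ne'
  set E := insert (i, k - 1) (D.erase (j, k)) with hE
  have hmem : ∀ x, x ∈ E ↔ x = (i, k - 1) ∨ x ≠ (j, k) ∧ x ∈ D := by simp [hE]
  have hc : E.card = D.card := by
    rw [Finset.card_insert_of_notMem (by simp [h4]), Finset.card_erase_add_one h3]
  have g1 : (i, k) ∈ E := by simp [hmem, h2, h1.ne]
  have g2 : (i, k - 1) ∈ E := by simp [hmem]
  have g3 : (i, k + 1) ∉ E := by
    simp only [hmem, h5, and_false, or_false, Prod.mk.injEq]; omega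
  have g4 : (i, k + 2) ∉ E := by
    simp only [hmem, h6, and_false, or_false, Prod.mk.injEq]; omega
  have g5 : ∀ a b : ℕ, a < i → i + k ≤ a + b + 2 → a + b ≤ i + k + 2 → (a, b) ∉ E := by
    intro a b ha hb hb'
    simp only [hmem, h8 a b ha hb hb', and_false, or_false, Prod.mk.injEq]
    omega
  have eE : (E.erase (i, k)).erase (i, k - 1) = (D.erase (i, k)).erase (j, k) := by
    rw [Finset.erase_right_comm, hE, Finset.erase_insert (by simp [h4]), Finset.erase_right_comm]
  have main : j + k + 2 ≤ n → (i + k) % 2 = 1 →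
      (Conj z (dreamPerm n D) ↔ Conj z (dreamPerm n E)) := by
    intro hjk hodd
    have hodd' := Nat.even_iff.mp hn
    rw [dreamPerm_two_first n hk g1 g2 g3 g4 g5, conj_adj_mul_adj_mul hn hodd (by omega), eE,
      dreamPerm_eq_adj_mul_erase n h2, dreamPerm_fpf_ladder (D := D.erase (i, k)) (k := k) h1 (by omega)]
    · intro x hx
      refine Finset.mem_erase.mpr ⟨?_, hX hx⟩
      rintro rfl
      simp [mem_ladderBlock] at hx
    · simp
    · simp [h5]
    · simp [h6]
    · simp [h3, hji]
    · simp [h7]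
    · intro a b ha hb hb' hx
      exact h8 a b ha hb hb' (Finset.mem_of_mem_erase hx)
    · rintro ⟨a, b⟩ hx ha hb e
      rw [ne_eq, Prod.mk.injEq] at e
      simp only at ha hb ⊢
      by_contra hc
      rcases Nat.lt_or_eq_of_le ha with h | rfl
      · exact h8 a b h (by omega) (by omega) hx
      · have : b = k + 1 ∨ b = k + 2 := by omega
        rcases this with rfl | rfl <;> contradiction
  constructor
  · intro hD
    have hjk : j + k + 2 ≤ n := hD.inTri _ h3
    refine hD.congr ?_ hc (main hjk (odd_of_top_rung hn hD h2 h5 h6 h8)).mp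
    intro x hx
    rcases (hmem x).mp hx with rfl | hx
    · simp only; omega
    · exact hD.inTri _ hx.2
  · intro hE'
    have hodd := odd_of_top_rung hn hE' g1 g3 g4 g5
    have hjk : j + k + 2 ≤ n := by
      -- With an empty block only `i + k + 2 ≤ n` is available. Since `n` is even and `i + k` is
      -- odd, equality is impossible, which gains the missing unit.
      by_cases e : j = i + 1
      · have := hE'.inTri _ g1
        have hn' := Nat.even_iff.mp hn
        simp only at this
        omega
      · have : (j - 1, k + 1) ∈ E := by
          rw [hmem]
          refine Or.inr ⟨by simp, hX ?_⟩
          simp only [mem_ladderBlock, or_true, and_true]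
          omega
        have := hE'.inTri _ this
        simp only at this
        omega
    refine hE'.congr ?_ hc.symm (main hjk hodd).mpr
    intro x hx
    by_cases e : x = (j, k)
    · rw [e]; exact hjk
    · exact hE'.inTri _ ((hmem x).mpr (Or.inr ⟨e, hx⟩))

theorem finite_sdiff_union_singleton {α : Type*} {D : Set α} (x y : α) :
    D.Finite ↔ (D \ {x} ∪ {y}).Finite := by
  refine ⟨fun h => (h.sdiff).union (Set.finite_singleton y), fun h => ?_⟩
  refine (h.union (Set.finite_singleton x)).subset fun t ht => ?_
  by_cases e : t = x
  · exact Or.inr e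
  · exact Or.inl (Or.inl ⟨ht, e⟩)

theorem finite_iff_of_move {D E : Set (ℕ × ℕ)} (h : LadderMove D E ∨ FpfLadderMove D E) :
    D.Finite ↔ E.Finite := by
  rcases h with ⟨i, j, k, -, -, -, -, -, -, rfl⟩ | ⟨i, j, k, -, -, -, -, -, -, -, -, -, rfl, -⟩ <;>
  exact finite_sdiff_union_singleton _ _

theorem mem_FDPlus_iff_of_move {n : ℕ} (hn : Even n) {z : Equiv.Perm (Fin n)} {D E : Set (ℕ × ℕ)}
    (h : LadderMove D E ∨ FpfLadderMove D E) : D ∈ FDPlus z ↔ E ∈ FDPlus z := by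
  have hfin := finite_iff_of_move h
  by_cases hD : D.Finite
  · have hE := hfin.mp hD
    lift D to Finset (ℕ × ℕ) using hD
    lift E to Finset (ℕ × ℕ) using hE
    rw [coe_mem_FDPlus_iff, coe_mem_FDPlus_iff]
    exact h.elim isFpfDream_iff_of_ladderMove (isFpfDream_iff_of_fpfLadderMove hn)
  -- Moves preserve finiteness, and an infinite set is never a pipe dream.
  · exact iff_of_false (fun h => hD (finite_of_mem_FDPlus h))
      fun h => hD (hfin.mpr (finite_of_mem_FDPlus h))

theorem mem_FDPlus_iff_of_FDLe {n : ℕ} (hn : Even n) {z : Equiv.Perm (Fin n)} {D E : Set (ℕ × ℕ)}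
    (h : FDLe D E) : D ∈ FDPlus z ↔ E ∈ FDPlus z := by
  induction h with
  | refl => rfl
  | tail _ h ih => exact ih.trans (mem_FDPlus_iff_of_move hn h)

/-! ### Left-justified pipe dreams and Lehmer codes -/

/-- The left-justified set of cells with `c r` cells in row `r`. -/
def leftJust (n : ℕ) (c : ℕ → ℕ) : Finset (ℕ × ℕ) :=
  (Finset.range n ×ˢ Finset.range n).filter fun x => x.2 < c x.1

theorem mem_leftJust {n : ℕ} {c : ℕ → ℕ} (hc : ∀ r < n, r + c r < n) {x : ℕ × ℕ} :
    x ∈ leftJust n c ↔ x.1 < n ∧ x.2 < c x.1 := by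
  simp only [leftJust, Finset.mem_filter, Finset.mem_product, Finset.mem_range]
  constructor
  · rintro ⟨⟨h1, -⟩, h2⟩
    exact ⟨h1, h2⟩
  · rintro ⟨h1, h2⟩
    have := hc _ h1
    exact ⟨⟨h1, by omega⟩, h2⟩

theorem inTri_leftJust {n : ℕ} {c : ℕ → ℕ} (hc : ∀ r < n, r + c r < n) :
    InTri n (leftJust n c) := by
  intro x hx
  rw [mem_leftJust hc] at hx
  have := hc _ hx.1
  omega

theorem card_leftJust {n : ℕ} {c : ℕ → ℕ} (hc : ∀ r < n, r + c r < n) :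
    (leftJust n c).card = ∑ i : Fin n, c i := by
  rw [leftJust, Finset.card_filter, Finset.sum_product, Finset.sum_range]
  refine Finset.sum_congr rfl fun i _ => ?_
  rw [← Finset.card_filter]
  have : (Finset.range n).filter (fun j => j < c i) = Finset.range (c i) := by
    ext j
    have := hc i i.2
    simp only [Finset.mem_filter, Finset.mem_range]
    omega
  simp only [this, Finset.card_range]

/-- The Lehmer code of a permutation. -/
def lehmer {n : ℕ} (w : Equiv.Perm (Fin n)) (i : Fin n) : ℕ :=
  (Finset.univ.filter fun j => i < j ∧ w j < w i).card

theorem sum_lehmer {n : ℕ} (w : Equiv.Perm (Fin n)) : ∑ i, lehmer w i = len w := by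
  simp only [lehmer, len, Finset.card_filter, Fintype.sum_prod_type]

/-- The first `m` cells of row `r`, read from east to west, multiply to the cycle sending `r` to `r
+ m` and lowering `r + 1, …, r + m` by one. -/
theorem dreamPerm_row_apply {n : ℕ} {c : ℕ → ℕ} (hc : ∀ r < n, r + c r < n) {r : ℕ} (hr : r < n)
    {m : ℕ} (hm : m ≤ c r) (i : Fin n) :
    (dreamPerm n (below (leftJust n c) r m) i).1 =
      if (dreamPerm n (below (leftJust n c) r 0) i).1 = r then r + m
      else if r < (dreamPerm n (below (leftJust n c) r 0) i).1 ∧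
        (dreamPerm n (below (leftJust n c) r 0) i).1 ≤ r + m
      then (dreamPerm n (below (leftJust n c) r 0) i).1 - 1
      else (dreamPerm n (below (leftJust n c) r 0) i).1 := by
  have hb := hc r hr
  induction m with
  | zero => split_ifs <;> omega
  | succ m ih =>
    have h : (r, m) ∈ leftJust n c := (mem_leftJust hc).mpr ⟨hr, by simp only; omega⟩
    rw [dreamPerm_below_succ h, Equiv.Perm.mul_apply, adj_val (by omega), ih (by omega)]
    generalize (dreamPerm n (below (leftJust n c) r 0) i).1 = v
    split_ifs <;> omega

/-- Adding row `r` gives position `r` the value `r + c r` and keeps the relative order of the values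
at later positions, so only the code entry at `r` is new. -/
theorem lehmer_below {n : ℕ} {c : ℕ → ℕ} (hc : ∀ r < n, r + c r < n) {r : ℕ} (hr : r ≤ n) :
    (∀ i : Fin n, i.1 < r → dreamPerm n (below (leftJust n c) r n) i = i) ∧
    ∀ i : Fin n, r ≤ i.1 → lehmer (dreamPerm n (below (leftJust n c) r n)) i = c i := by
  induction hr using Nat.decreasingInduction with
  | self =>
    rw [below_last (inTri_leftJust hc), dreamPerm_empty]
    exact ⟨fun _ _ => rfl, fun i hi => absurd i.2 (not_lt.mpr hi)⟩
  | of_succ r hr ih =>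
    rw [← below_row (inTri_leftJust hc)] at ih
    have e : below (leftJust n c) r n = below (leftJust n c) r (c r) := by
      ext ⟨a, b⟩
      simp only [mem_below, mem_leftJust hc]
      constructor
      · rintro ⟨⟨h1, h2⟩, h3⟩
        refine ⟨⟨h1, h2⟩, h3.imp_right ?_⟩
        rintro ⟨rfl, -⟩
        exact ⟨rfl, h2⟩
      · rintro ⟨⟨h1, h2⟩, h3⟩
        refine ⟨⟨h1, h2⟩, h3.imp_right ?_⟩
        rintro ⟨rfl, h4⟩
        exact ⟨rfl, h4.trans (by have := hc a h1; omega)⟩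
    have hu := dreamPerm_row_apply hc hr le_rfl
    rw [← e] at hu
    have hcr := hc r hr
    generalize dreamPerm n (below (leftJust n c) r 0) = u' at ih hu
    generalize dreamPerm n (below (leftJust n c) r n) = u at hu ⊢
    obtain ⟨ih1, ih2⟩ := ih
    have hgt : ∀ i : Fin n, r < i.1 → r < (u' i).1 := by
      intro i hi
      by_contra hlt
      have h1 := u'.injective (ih1 (u' i) (by omega))
      rw [h1] at hlt
      exact hlt hi
    have hr' : (u' ⟨r, hr⟩).1 = r := by rw [ih1 _ (Nat.lt_succ_self r)]
    have hfix : ∀ i : Fin n, i.1 < r → u i = i := by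
      intro i hi
      have h1 := hu i
      rw [ih1 i (by omega)] at h1
      apply Fin.ext
      rw [h1]
      split_ifs <;> omega
    refine ⟨hfix, fun i hi => ?_⟩
    rcases Nat.lt_or_eq_of_le hi with hi | hi
    · rw [← ih2 i hi, lehmer, lehmer]
      congr 1
      ext j
      simp only [Finset.mem_filter, Finset.mem_univ, true_and, and_congr_right_iff, Fin.lt_def]
      intro hj
      have h1 := hgt i hi
      have h2 := hgt j (by omega)
      rw [hu, hu]
      split_ifs <;> omega
    · obtain rfl : i = ⟨r, hr⟩ := Fin.ext hi.symm
      have hur : (u ⟨r, hr⟩).1 = r + c r := by rw [hu, if_pos hr']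
      rw [lehmer, ← Finset.card_map u.toEmbedding]
      have : (Finset.univ.filter fun j => (⟨r, hr⟩ : Fin n) < j ∧ u j < u ⟨r, hr⟩).map
          u.toEmbedding = Finset.Ico ⟨r, hr⟩ ⟨r + c r, hcr⟩ := by
        ext v
        simp only [Finset.mem_map, Finset.mem_filter, Finset.mem_univ, true_and,
          Equiv.coe_toEmbedding, Finset.mem_Ico, Fin.lt_def, Fin.le_def, hur]
        constructor
        · rintro ⟨j, ⟨h1, h2⟩, rfl⟩
          refine ⟨?_, h2⟩
          have := hgt j h1
          rw [hu]
          split_ifs <;> omega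
        · rintro ⟨h1, h2⟩
          obtain ⟨j, rfl⟩ := u.surjective v
          refine ⟨j, ⟨?_, h2⟩, rfl⟩
          by_contra hj
          rcases Nat.lt_or_eq_of_le (not_lt.mp hj) with hj | hj
          · rw [hfix j hj] at h1
            omega
          · obtain rfl : j = ⟨r, hr⟩ := Fin.ext hj
            omega
      rw [this, Fin.card_Ico]
      simp

theorem lehmer_leftJust {n : ℕ} {c : ℕ → ℕ} (hc : ∀ r < n, r + c r < n) (i : Fin n) :
    lehmer (dreamPerm n (leftJust n c)) i = c i := by
  have := (lehmer_below hc (Nat.zero_le n)).2 i (Nat.zero_le _)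
  rwa [below_zero (inTri_leftJust hc)] at this

/-- Every permutation has a left-justified reduced pipe dream. -/
theorem exists_leftJust {n : ℕ} (w : Equiv.Perm (Fin n)) :
    ∃ c : ℕ → ℕ, (∀ r < n, r + c r < n) ∧ dreamPerm n (leftJust n c) = w := by
  let code : (∀ r : Fin n, Fin (n - r)) → ℕ → ℕ := fun f r => if h : r < n then f ⟨r, h⟩ else 0
  have hcode : ∀ f, ∀ r < n, r + code f r < n := by
    intro f r hr
    have h : (f ⟨r, hr⟩).1 < n - r := (f ⟨r, hr⟩).2
    simp only [code, dif_pos hr]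
    omega
  have hinj : Function.Injective fun f => dreamPerm n (leftJust n (code f)) := by
    intro f g hfg
    funext r
    have h1 := lehmer_leftJust (hcode f) r
    have h2 := lehmer_leftJust (hcode g) r
    simp only at hfg
    rw [hfg, h2] at h1
    simp only [code, r.2, dif_pos] at h1
    exact Fin.ext h1.symm
  -- There are `n!` codes, and distinct codes give distinct permutations, so every permutation is
  -- reached.
  have hcard : Fintype.card (∀ r : Fin n, Fin (n - r)) = Fintype.card (Equiv.Perm (Fin n)) := by
    rw [Fintype.card_pi, Fintype.card_perm, Fintype.card_fin]
    simp only [Fintype.card_fin]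
    rw [← Finset.prod_range (fun i => n - i), ← Finset.prod_range_reflect,
      ← Finset.prod_range_add_one_eq_factorial]
    refine Finset.prod_congr rfl fun i hi => ?_
    rw [Finset.mem_range] at hi
    omega
  obtain ⟨f, hf⟩ := ((Fintype.bijective_iff_injective_and_card _).mpr ⟨hinj, hcard⟩).2 w
  exact ⟨code f, hcode f, hf⟩

/-! ### Existence of atoms -/

theorem sq_eq_one_of_fpf {n : ℕ} {z : Equiv.Perm (Fin n)} (hz : IsFpfInvolution z) : z ^ 2 = 1 :=
  Equiv.ext fun i => by rw [sq, Equiv.Perm.mul_apply, hz.1, Equiv.Perm.one_apply]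

theorem card_support_of_fpf {n : ℕ} {z : Equiv.Perm (Fin n)} (hz : IsFpfInvolution z) :
    z.support.card = n := by
  have : z.support = Finset.univ := by
    ext i
    simp [hz.2 i]
  rw [this, Finset.card_univ, Fintype.card_fin]

theorem even_of_fpf {n : ℕ} {z : Equiv.Perm (Fin n)} (hz : IsFpfInvolution z) : Even n := by
  have := Equiv.Perm.two_dvd_card_support (sq_eq_one_of_fpf hz)
  rw [card_support_of_fpf hz] at this
  exact even_iff_two_dvd.mpr this

theorem isFpfInvolution_fpfBase {n : ℕ} (hn : Even n) : IsFpfInvolution (fpfBase n) := by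
  refine ⟨fun i => baseFun_involutive n i, fun i h => ?_⟩
  have := congrArg Fin.val h
  rw [fpfBase_val hn] at this
  split_ifs at this <;> omega

theorem cycleType_of_fpf {n : ℕ} {z : Equiv.Perm (Fin n)} (hz : IsFpfInvolution z) :
    z.cycleType = Multiset.replicate (n / 2) 2 := by
  have h1 := Equiv.Perm.cycleType_of_pow_prime_eq_one (sq_eq_one_of_fpf hz)
  have h2 := z.sum_cycleType
  rw [card_support_of_fpf hz, h1, Multiset.sum_replicate, smul_eq_mul] at h2
  rw [h1]
  congr 1
  omega

theorem exists_conj {n : ℕ} {z : Equiv.Perm (Fin n)} (hz : IsFpfInvolution z) :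
    ∃ v, Conj z v := by
  have h : IsConj (fpfBase n) z := by
    rw [Equiv.Perm.isConj_iff_cycleType_eq, cycleType_of_fpf hz,
      cycleType_of_fpf (isFpfInvolution_fpfBase (even_of_fpf hz))]
  obtain ⟨c, hc⟩ := isConj_iff.mp h
  refine ⟨c⁻¹, ?_⟩
  rw [Conj, inv_inv, hc]

/-- Equal cycle types give some conjugating element. One of minimal length has a left-justified pipe
dream. -/
theorem exists_isFpfDream {n : ℕ} {z : Equiv.Perm (Fin n)} (hz : IsFpfInvolution z) :
    ∃ D, IsFpfDream z D := by
  classical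
  obtain ⟨v₀, hv₀⟩ := exists_conj hz
  obtain ⟨v, hv, hmin⟩ := (Finset.univ.filter fun v => Conj z v).exists_min_image len
    ⟨v₀, by simpa using hv₀⟩
  obtain ⟨c, hc, rfl⟩ := exists_leftJust v
  refine ⟨leftJust n c, inTri_leftJust hc, by simpa using hv, fun u hu => ?_⟩
  refine le_trans (le_of_eq ?_) (hmin u (by simpa using hu))
  rw [card_leftJust hc, ← sum_lehmer]
  exact Finset.sum_congr rfl fun i _ => (lehmer_leftJust hc i).symm

/-! ### Minimal elements -/

/-- A reduced set of cells that is not left-justified admits an inverse ladder move. -/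
theorem exists_ladderMove {n : ℕ} {D : Finset (ℕ × ℕ)} (hD : InTri n D)
    (hlen : len (dreamPerm n D) = D.card) (h : ∃ r c, (r, c + 1) ∈ D ∧ (r, c) ∉ D) :
    ∃ E : Finset (ℕ × ℕ), LadderMove (E : Set (ℕ × ℕ)) D := by
  classical
  obtain ⟨r, c, hr, hr'⟩ := h
  -- Choosing a gap in the lowest possible row makes every lower row left-justified; the first row
  -- below `i` without a cell in column `k + 1` then ends the ladder.
  obtain ⟨⟨i, k'⟩, hx, hmax⟩ := (D.filter fun x => ∃ k, x.2 = k + 1 ∧ (x.1, k) ∉ D).exists_max_image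
    Prod.fst ⟨(r, c + 1), Finset.mem_filter.mpr ⟨hr, c, rfl, hr'⟩⟩
  rw [Finset.mem_filter] at hx
  obtain ⟨h1, k, hk, h2⟩ := hx
  simp only at hk h2
  subst hk
  have hmax' : ∀ j, i < j → (j, k + 1) ∈ D → (j, k) ∈ D := by
    intro j hj h3
    by_contra h4
    have := hmax (j, k + 1) (Finset.mem_filter.mpr ⟨h3, k, rfl, h4⟩)
    exact absurd hj (not_lt.mpr this)
  have hex : ∃ j, i < j ∧ (j, k + 1) ∉ D :=
    ⟨i + n + 1, by omega, fun h => by have := hD _ h; simp only at this; omega⟩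
  obtain ⟨hij, hj⟩ := Nat.find_spec hex
  have hmin : ∀ m, i < m → m < Nat.find hex → (m, k) ∈ D ∧ (m, k + 1) ∈ D := by
    intro m hm hm'
    have h3 := Nat.find_min hex hm'
    push Not at h3
    exact ⟨hmax' m hm (h3 hm), h3 hm⟩
  generalize Nat.find hex = j at hij hj hmin
  -- If `(j, k)` were occupied, the two ends of the ladder would cancel, contradicting reducedness.
  by_cases hjk : (j, k) ∈ D
  · exfalso
    have hX : ladderBlock i j k ⊆ D := by
      rintro ⟨a, b⟩ hx
      rw [mem_ladderBlock] at hx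
      obtain ⟨ha, hb, e | e⟩ := hx <;> simp only at ha hb e <;> subst e
      · exact (hmin a ha hb).1
      · exact (hmin a ha hb).2
    have hn := hD _ hjk
    simp only at hn
    have h3 := dreamPerm_ladder_cancel (n := n) hij (by omega) hX hjk h2 h1 hj
    have h4 := len_dreamPerm_le (n := n) ((D.erase (j, k)).erase (i, k + 1))
    rw [h3, hlen] at h4
    have h5 := Finset.card_erase_le (s := D.erase (j, k)) (a := (i, k + 1))
    have h6 := Finset.card_erase_add_one hjk
    omega
  · refine ⟨insert (j, k) (D.erase (i, k + 1)), i, j, k, hij, ?_, by simp, ?_, ?_, ?_, ?_⟩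
    · intro m hm hm'
      obtain ⟨h3, h4⟩ := hmin m hm hm'
      have : m ≠ i := by omega
      simp [h3, h4, this]
    · simp [h2, hij.ne]
    · simp
    · simp [hj]
    · ext x
      simp only [Finset.coe_insert, Finset.coe_erase, Set.mem_union, Set.mem_sdiff,
        Set.mem_insert_iff, Set.mem_singleton_iff, Finset.mem_coe]
      constructor
      · intro hx
        by_cases e : x = (i, k + 1)
        · exact Or.inr e
        · refine Or.inl ⟨Or.inr ⟨hx, e⟩, ?_⟩
          rintro rfl
          exact hjk hx
      · rintro (⟨rfl | hx, hx'⟩ | rfl)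
        · exact absurd rfl hx'
        · exact hx.1
        · exact h1

theorem exists_eq_leftJust {n : ℕ} {D : Finset (ℕ × ℕ)} (hD : InTri n D)
    (h : ∀ r c, (r, c + 1) ∈ D → (r, c) ∈ D) :
    ∃ c : ℕ → ℕ, (∀ r < n, r + c r < n) ∧ D = leftJust n c := by
  classical
  have hex : ∀ r, ∃ c, (r, c) ∉ D :=
    fun r => ⟨n, fun h => by have := hD _ h; simp only at this; omega⟩
  have hc : ∀ r b, (r, b) ∈ D ↔ b < Nat.find (hex r) := by
    intro r b
    constructor
    · intro hb
      by_contra hle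
      rw [not_lt] at hle
      induction b, hle using Nat.le_induction with
      | base => exact Nat.find_spec (hex r) hb
      | succ b _ ih => exact ih (h r b hb)
    · intro hb
      simpa using Nat.find_min (hex r) hb
  have hlt : ∀ r < n, r + Nat.find (hex r) < n := by
    intro r hr
    rcases Nat.eq_zero_or_pos (Nat.find (hex r)) with h0 | h0
    · omega
    · have := hD _ ((hc r (Nat.find (hex r) - 1)).mpr (by omega))
      simp only at this
      omega
  refine ⟨fun r => Nat.find (hex r), hlt, ?_⟩
  ext ⟨r, b⟩
  rw [mem_leftJust hlt, hc]
  refine ⟨fun hb => ⟨?_, hb⟩, fun hb => hb.2⟩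
  have := hD _ ((hc r b).mpr hb)
  simp only at this ⊢
  omega

/-! ### Codes of atoms and inverse fpf ladder moves -/

theorem apply_of_conj {n : ℕ} {z w : Equiv.Perm (Fin n)} (h : Conj z w) (i : Fin n) :
    w (z i) = fpfBase n (w i) := by
  rw [h, Equiv.Perm.mul_apply, Equiv.Perm.mul_apply, Equiv.Perm.inv_def, Equiv.apply_symm_apply]

/-- If the larger element of a cycle received the even value, exchanging the two values of the cycle
would shorten `w` and still conjugate to `z`. -/
theorem lt_apply_of_conj {n : ℕ} (hn : Even n) {z w : Equiv.Perm (Fin n)}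
    (hz : IsFpfInvolution z) (h : Conj z w) (hmin : ∀ v, Conj z v → len w ≤ len v) {i : Fin n}
    (hi : (w i).1 % 2 = 0) : i < z i := by
  by_contra hlt
  have hlt : z i < i := lt_of_le_of_ne (not_lt.mp hlt) (hz.2 i)
  have h1 : (w (z i)).1 = (w i).1 + 1 := by
    rw [apply_of_conj h, fpfBase_val hn, if_neg (by omega)]
  have h2 : (w i).1 + 1 < n := h1 ▸ (w (z i)).2
  have h3 := len_adj_mul_of_gt h2 w rfl h1 hlt
  have h4 := hmin _ ((conj_adj_mul hn hi).mpr h)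
  omega

theorem add_lehmer {n : ℕ} (w : Equiv.Perm (Fin n)) (i : Fin n) :
    i.1 + lehmer w i = (Finset.univ.filter fun j => j < i ∨ i < j ∧ w j < w i).card := by
  rw [Finset.filter_or, Finset.card_union_of_disjoint, lehmer]
  · congr 1
    have : Finset.univ.filter (fun j => j < i) = Finset.Iio i := by ext; simp
    rw [this, Fin.card_Iio]
  · rw [Finset.disjoint_filter]
    intro j _ h1 h2
    exact lt_asymm h1 h2.1

/-- The Lehmer code of an fpf-atom is the fpf-involution code or allows an inverse fpf ladder
move. -/
theorem lehmer_eq_fpfCode_or {n : ℕ} (hn : Even n) {z w : Equiv.Perm (Fin n)}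
    (hz : IsFpfInvolution z) (h : Conj z w) (hmin : ∀ v, Conj z v → len w ≤ len v) :
    (∀ i, lehmer w i = fpfCode z i) ∨
      ∃ i, 2 ≤ lehmer w i ∧ ∀ r < i, r.1 + lehmer w r + 3 ≤ i.1 + lehmer w i := by
  have hF : ∀ i, (w (z i)).1 = if (w i).1 % 2 = 1 then (w i).1 - 1 else (w i).1 + 1 :=
    fun i => by rw [apply_of_conj h, fpfBase_val hn]
  have hev : ∀ i, (w i).1 % 2 = 0 → i.1 < (z i).1 ∧ (w (z i)).1 = (w i).1 + 1 := by
    intro i hi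
    refine ⟨lt_apply_of_conj hn hz h hmin hi, ?_⟩
    rw [hF, if_neg (by omega)]
  have hod : ∀ i, (w i).1 % 2 = 1 →
      (z i).1 < i.1 ∧ (w (z i)).1 + 1 = (w i).1 ∧ (w (z i)).1 % 2 = 0 := by
    intro i hi
    have h1 := hF i
    rw [if_pos hi] at h1
    have h2 := hev (z i) (by omega)
    rw [hz.1] at h2
    omega
  have hinj : ∀ {i j : Fin n}, (w i).1 = (w j).1 → i.1 = j.1 :=
    fun e => congrArg Fin.val (w.injective (Fin.ext e))
  -- The elements with even value are the smaller elements of the cycles of `z`. The question is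
  -- whether `w` orders the cycles by their smaller elements; if not, take the first violation.
  by_cases hbad : ∃ i, (w i).1 % 2 = 0 ∧ ∃ i', (w i').1 % 2 = 0 ∧ (w i').1 < (w i).1 ∧ i < i'
  · right
    obtain ⟨i, ⟨hi, i', hi', hw, hlt⟩, hm⟩ := wellFounded_lt.has_min
      {i | (w i).1 % 2 = 0 ∧ ∃ i', (w i').1 % 2 = 0 ∧ (w i').1 < (w i).1 ∧ i < i'} hbad
    have hgood : ∀ e, e < i → (w e).1 % 2 = 0 → ∀ e', (w e').1 % 2 = 0 → (w e').1 < (w e).1 →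
        e' ≤ e := by
      intro e he h1 e' h2 h3
      by_contra hc
      exact hm e ⟨h1, e', h2, h3, not_le.mp hc⟩ he
    have hbefore : ∀ j, j < i → (w j).1 < (w i).1 := by
      have key : ∀ j, j < i → (w j).1 % 2 = 0 → (w j).1 < (w i).1 := by
        intro j hj hj'
        by_contra hc
        have h1 : (w i).1 ≠ (w j).1 := fun e => by
          have := hinj e
          rw [Fin.lt_def] at hj
          omega
        have := hgood j hj hj' i hi (by omega)
        exact absurd hj (not_lt.mpr this)
      intro j hj
      rcases Nat.mod_two_eq_zero_or_one (w j).1 with h1 | h1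
      · exact key j hj h1
      · have h2 := hod j h1
        have := key (z j) (lt_trans h2.1 hj) h2.2.2
        omega
    have hzi' := hev i' hi'
    rw [Fin.lt_def] at hlt
    refine ⟨i, ?_, ?_⟩
    · rw [lehmer, Nat.succ_le_iff, Finset.one_lt_card]
      refine ⟨i', ?_, z i', ?_, (hz.2 i').symm⟩ <;>
        simp only [Finset.mem_filter, Finset.mem_univ, true_and, Fin.lt_def] <;> omega
    · intro r hr
      rw [add_lehmer, add_lehmer]
      have hwr := hbefore r hr
      have hnot : ¬ (w i').1 < (w r).1 := by
        intro hc
        rcases Nat.mod_two_eq_zero_or_one (w r).1 with h1 | h1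
        · have := hgood r hr h1 i' hi' hc
          rw [Fin.le_def] at this
          rw [Fin.lt_def] at hr
          omega
        · have h2 := hod r h1
          rw [Fin.lt_def] at hr
          rcases Nat.lt_or_ge (w i').1 (w (z r)).1 with h3 | h3
          · have := hgood (z r) (by rw [Fin.lt_def]; omega) h2.2.2 i' hi' h3
            rw [Fin.le_def] at this
            omega
          · have := hinj (i := i') (j := z r) (by omega)
            omega
      rw [Fin.lt_def] at hr
      -- By `add_lehmer` both sums count sets of positions. The set for `i` contains the one for `r`
      -- and also the three new positions `r`, `i'` and `z i'`, which explains the constant `3`.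
      have hsub : insert r (insert i' (insert (z i')
          (Finset.univ.filter fun j => j < r ∨ r < j ∧ w j < w r))) ⊆
          Finset.univ.filter fun j => j < i ∨ i < j ∧ w j < w i := by
        intro j
        simp only [Finset.mem_insert, Finset.mem_filter, Finset.mem_univ, true_and, Fin.lt_def]
        rintro (rfl | rfl | rfl | h1)
        · omega
        · omega
        · omega
        · rcases lt_trichotomy j.1 i.1 with h2 | h2 | h2
          · exact Or.inl h2
          · obtain rfl : j = i := Fin.ext h2
            omega
          · omega
      refine le_trans (le_of_eq ?_) (Finset.card_le_card hsub)
      rw [Finset.card_insert_of_notMem, Finset.card_insert_of_notMem, Finset.card_insert_of_notMem]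
      · simp only [Finset.mem_filter, Finset.mem_univ, true_and, Fin.lt_def]
        omega
      · simp only [Finset.mem_insert, Finset.mem_filter, Finset.mem_univ, true_and, Fin.lt_def,
          Fin.ext_iff]
        omega
      · simp only [Finset.mem_insert, Finset.mem_filter, Finset.mem_univ, true_and, Fin.lt_def,
          Fin.ext_iff]
        omega
  · left
    have hmono : ∀ a b : Fin n, (w a).1 % 2 = 0 → (w b).1 % 2 = 0 →
        (a.1 < b.1 ↔ (w a).1 < (w b).1) := by
      have key : ∀ a b : Fin n, (w a).1 % 2 = 0 → (w b).1 % 2 = 0 → (w b).1 < (w a).1 →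
          b.1 < a.1 := by
        intro a b ha hb hab
        by_contra hc
        have h1 : a.1 ≠ b.1 := by
          intro e
          rw [Fin.ext e] at hab
          exact lt_irrefl _ hab
        exact hbad ⟨a, ha, b, hb, hab, by rw [Fin.lt_def]; omega⟩
      intro a b ha hb
      refine ⟨fun hab => ?_, key b a hb ha⟩
      by_contra hc
      have h1 : (w b).1 ≠ (w a).1 := fun e => by have := hinj e; omega
      have := key a b ha hb (by omega)
      omega
    -- As `w` orders the cycles by their smaller elements, each inversion of `w` is determined by
    -- comparing these elements; the four parity cases reproduce the condition in `fpfCode`.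
    intro r
    rw [lehmer, fpfCode]
    congr 1
    ext j
    simp only [Finset.mem_filter, Finset.mem_univ, true_and, and_congr_right_iff, Fin.lt_def]
    intro hrj
    rcases Nat.mod_two_eq_zero_or_one (w r).1 with hr | hr <;>
      rcases Nat.mod_two_eq_zero_or_one (w j).1 with hj | hj
    · have h1 := hmono r j hr hj
      have h2 := hev j hj
      omega
    · have h2 := hod j hj
      have h3 := hev r hr
      have h1 := hmono (z j) r h2.2.2 hr
      omega
    · have h2 := hod r hr
      have h3 := hev j hj
      have h1 := hmono (z r) j h2.2.2 hj
      omega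
    · have h2 := hod r hr
      have h3 := hod j hj
      have h1 := hmono (z j) (z r) h3.2.2 h2.2.2
      omega

/-- The last two cells of row `i` serve as the top rung after the move. The gap of `3` over all
earlier rows clears the antidiagonals that the move requires to be empty. -/
theorem exists_fpfLadderMove {n : ℕ} (hn : Even n) {z : Equiv.Perm (Fin n)} {c : ℕ → ℕ}
    (hc : ∀ r < n, r + c r < n) (hD : IsFpfDream z (leftJust n c)) {i : ℕ} (hi : i < n)
    (hci : 2 ≤ c i) (hlt : ∀ r < i, r + c r + 3 ≤ i + c i) :
    ∃ E : Finset (ℕ × ℕ), FpfLadderMove (E : Set (ℕ × ℕ)) (leftJust n c : Finset (ℕ × ℕ)) := by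
  classical
  have hmem : ∀ a b, (a, b) ∈ leftJust n c ↔ a < n ∧ b < c a := fun a b => mem_leftJust hc
  obtain ⟨k, hk⟩ : ∃ k, c i = k + 1 := ⟨c i - 1, by omega⟩
  have hex : ∃ j, i < j ∧ (j, k + 1) ∉ leftJust n c :=
    ⟨i + n + 1, by omega, fun h => by rw [hmem] at h; omega⟩
  obtain ⟨hij, hj⟩ := Nat.find_spec hex
  have hmin : ∀ m, i < m → m < Nat.find hex →
      (m, k) ∈ leftJust n c ∧ (m, k + 1) ∈ leftJust n c := by
    intro m hm hm'
    have h3 := Nat.find_min hex hm'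
    push Not at h3
    have h4 := h3 hm
    refine ⟨?_, h4⟩
    rw [hmem] at h4 ⊢
    omega
  generalize Nat.find hex = j at hij hj hmin
  have h1 : (i, k) ∈ leftJust n c := by rw [hmem]; omega
  have h2 : (i, k - 1) ∈ leftJust n c := by rw [hmem]; omega
  have h3 : (i, k + 1) ∉ leftJust n c := by rw [hmem]; omega
  have h4 : (i, k + 2) ∉ leftJust n c := by rw [hmem]; omega
  have h5 : ∀ a b : ℕ, a < i → i + k ≤ a + b + 2 → a + b ≤ i + k + 2 →
      (a, b) ∉ leftJust n c := by
    intro a b ha hb hb'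
    rw [hmem]
    have := hlt a ha
    omega
  have hk1 : k ≠ k - 1 := by omega
  have hji : j ≠ i := hij.ne'
  -- If `(j, k)` were occupied, the word would be `s_a s_{a-1} s_{a+1} v` with `a = i + k` odd.
  -- Replacing `s_{a-1}` by `s_{a+1}` cancels two letters, contradicting minimality.
  by_cases hjk : (j, k) ∈ leftJust n c
  · exfalso
    have hodd := odd_of_top_rung hn hD h1 h3 h4 h5
    have hjn := hD.inTri _ hjk
    simp only at hjn
    have e := dreamPerm_two_first n (by omega) h1 h2 h3 h4 h5
    have hcard1 := Finset.card_erase_add_one h1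
    have h2' : (i, k - 1) ∈ (leftJust n c).erase (i, k) := by
      rw [Finset.mem_erase, ne_eq, Prod.mk.injEq]
      exact ⟨fun h => hk1 h.2.symm, h2⟩
    have hcard2 := Finset.card_erase_add_one h2'
    set G := ((leftJust n c).erase (i, k)).erase (i, k - 1) with hG
    have hGD : ∀ x, x ∈ G ↔ x ≠ (i, k - 1) ∧ x ≠ (i, k) ∧ x ∈ leftJust n c := by simp [hG]
    have hjG : (j, k) ∈ G := by simp [hGD, hjk, hji]
    have hcard3 := Finset.card_erase_add_one hjG
    have e2 : dreamPerm n G = adj n (i + k + 1) * dreamPerm n (G.erase (j, k)) := by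
      refine dreamPerm_fpf_ladder hij (by omega) ?_ ?_ ?_ ?_ hjG ?_ ?_
      · rintro ⟨a, b⟩ hx
        rw [mem_ladderBlock] at hx
        have ha : a ≠ i := by simp only at hx; omega
        rw [hGD, ne_eq, ne_eq, Prod.mk.injEq, Prod.mk.injEq]
        refine ⟨fun h => ha h.1, fun h => ha h.1, ?_⟩
        obtain ⟨ha, hb, e | e⟩ := hx <;> simp only at ha hb e <;> subst e
        · exact (hmin a ha hb).1
        · exact (hmin a ha hb).2
      · simp [hGD]
      · simp [hGD, h3]
      · simp [hGD, h4]
      · simp [hGD, hj]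
      · intro a b ha hb hb'
        simp [hGD, h5 a b ha hb hb']
    have hz := hD.conj
    have hn' := Nat.even_iff.mp hn
    rw [e, conj_adj_mul_adj_mul hn hodd (by omega), e2,
      ← mul_assoc (adj n (i + k + 1)) (adj n (i + k + 1)), adj_mul_self, one_mul] at hz
    have h6 := hD.card_le _ hz
    have h7 := len_adj_mul_le (i + k) (dreamPerm n (G.erase (j, k)))
    have h8 := len_dreamPerm_le (n := n) (G.erase (j, k))
    omega
  · have hmE : ∀ x, x ∈ insert (j, k) ((leftJust n c).erase (i, k - 1)) ↔
        x = (j, k) ∨ x ≠ (i, k - 1) ∧ x ∈ leftJust n c := by simp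
    refine ⟨insert (j, k) ((leftJust n c).erase (i, k - 1)), i, j, k, hij, by omega, ?_⟩
    simp only [Finset.mem_coe, hmE]
    refine ⟨?_, ?_, by simp, ?_, ?_, ?_, ?_, ?_, ?_⟩
    · intro m hm hm'
      obtain ⟨h6, h7⟩ := hmin m hm hm'
      have : m ≠ i := by omega
      simp [h6, h7, this]
    · simp [h1, hk1]
    · simp [hij.ne]
    · simp [h3, hij.ne]
    · simp [h4, hij.ne]
    · simp [hj]
    · ext x
      simp only [Set.mem_union, Set.mem_sdiff, Set.mem_singleton_iff, Finset.mem_coe, hmE]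
      constructor
      · intro hx
        by_cases e : x = (i, k - 1)
        · exact Or.inr e
        · refine Or.inl ⟨Or.inr ⟨e, hx⟩, ?_⟩
          rintro rfl
          exact hjk hx
      · rintro (⟨rfl | hx, hx'⟩ | rfl)
        · exact absurd rfl hx'
        · exact hx.2
        · exact h2
    · intro a b ha hb hb'
      have := h5 a b ha hb hb'
      simp only [this, and_false, or_false, Prod.mk.injEq]
      omega

/-- A minimal element is the bottom fpf-involution pipe dream. -/
theorem eq_bottomFpf_or_exists_move {n : ℕ} {z : Equiv.Perm (Fin n)} (hz : IsFpfInvolution z)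
    {D : Finset (ℕ × ℕ)} (hD : IsFpfDream z D) :
    (D : Set (ℕ × ℕ)) = bottomFpf z ∨
      ∃ E : Finset (ℕ × ℕ), LadderMove (E : Set (ℕ × ℕ)) D ∨ FpfLadderMove (E : Set (ℕ × ℕ)) D := by
  have hn := even_of_fpf hz
  by_cases hlj : ∃ r c, (r, c + 1) ∈ D ∧ (r, c) ∉ D
  · obtain ⟨E, hE⟩ := exists_ladderMove hD.inTri hD.len_eq hlj
    exact Or.inr ⟨E, Or.inl hE⟩
  · push Not at hlj
    obtain ⟨c, hc, rfl⟩ := exists_eq_leftJust hD.inTri hlj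
    have hcode := lehmer_leftJust hc
    rcases lehmer_eq_fpfCode_or hn hz hD.conj hD.isFpfAtom.2 with h | ⟨i, h1, h2⟩
    · left
      ext x
      rw [Finset.mem_coe, mem_leftJust hc, bottomFpf, Set.mem_ofPred_eq]
      constructor
      · rintro ⟨h1, h2⟩
        refine ⟨h1, ?_⟩
        rwa [← h, hcode]
      · rintro ⟨h1, h2⟩
        refine ⟨h1, ?_⟩
        rwa [← h, hcode] at h2
    · right
      rw [hcode] at h1
      obtain ⟨E, hE⟩ := exists_fpfLadderMove hn hc hD i.2 h1 fun r hr => by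
        have := h2 ⟨r, hr.trans i.2⟩ hr
        rwa [hcode, hcode] at this
      exact ⟨E, Or.inr hE⟩

/-! ### The order -/

/-- The sum of the row indices of the cells. -/
def weight (D : Finset (ℕ × ℕ)) : ℕ := ∑ x ∈ D, x.1

theorem weight_insert_erase {D : Finset (ℕ × ℕ)} {x y : ℕ × ℕ} (hx : x ∈ D) (hy : y ∉ D)
    (h : y.1 < x.1) : (insert y (D.erase x)).card = D.card ∧ weight (insert y (D.erase x)) < weight D := by
  have hy' : y ∉ D.erase x := fun h => hy (Finset.mem_of_mem_erase h)
  refine ⟨by rw [Finset.card_insert_of_notMem hy', Finset.card_erase_add_one hx], ?_⟩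
  rw [weight, weight, Finset.sum_insert hy', ← Finset.add_sum_erase D _ hx]
  omega

theorem card_weight_of_move {D E : Finset (ℕ × ℕ)}
    (h : LadderMove (D : Set (ℕ × ℕ)) E ∨ FpfLadderMove (D : Set (ℕ × ℕ)) E) :
    E.card = D.card ∧ weight E < weight D := by
  rcases h with h | h
  · obtain ⟨i, j, k, h1, -, h2, -, h3, -, rfl⟩ := ladderMove_coe h
    exact weight_insert_erase h2 h3 h1
  · obtain ⟨i, j, k, h1, -, -, -, h2, h3, -, -, -, rfl, -⟩ := fpfLadderMove_coe h
    exact weight_insert_erase h2 h3 h1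

theorem eq_or_weight_lt_of_FDLe {D : Finset (ℕ × ℕ)} {E : Set (ℕ × ℕ)}
    (h : FDLe (D : Set (ℕ × ℕ)) E) :
    ∃ E' : Finset (ℕ × ℕ), E = E' ∧ (E' = D ∨ weight E' < weight D) := by
  induction h with
  | refl => exact ⟨D, rfl, Or.inl rfl⟩
  | tail _ h ih =>
    obtain ⟨E', rfl, hE'⟩ := ih
    have hfin := (finite_iff_of_move h).mp E'.finite_toSet
    refine ⟨hfin.toFinset, by simp, Or.inr ?_⟩
    have := (card_weight_of_move (D := E') (E := hfin.toFinset) (by simpa using h)).2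
    rcases hE' with rfl | hE'
    · exact this
    · exact this.trans hE'

theorem FDLe_antisymm {D E : Finset (ℕ × ℕ)} (h : FDLe (D : Set (ℕ × ℕ)) E)
    (h' : FDLe (E : Set (ℕ × ℕ)) D) : D = E := by
  obtain ⟨E', h1, h2⟩ := eq_or_weight_lt_of_FDLe h
  obtain ⟨D', h3, h4⟩ := eq_or_weight_lt_of_FDLe h'
  rw [Finset.coe_inj] at h1 h3
  subst h1 h3
  rcases h2 with h2 | h2
  · exact h2.symm
  · rcases h4 with h4 | h4
    · exact h4
    · omega

/-- Inverse moves raise `weight`, which is at most `n * D.card` because the cells lie in the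
triangle. The descent therefore stops, and it can stop only at the bottom element. -/
theorem bottomFpf_le {n : ℕ} {z : Equiv.Perm (Fin n)} (hz : IsFpfInvolution z)
    {D : Finset (ℕ × ℕ)} (hD : IsFpfDream z D) : FDLe (bottomFpf z) D := by
  induction hk : n * D.card - weight D using Nat.strong_induction_on generalizing D with
  | _ k ih =>
    rcases eq_bottomFpf_or_exists_move hz hD with h | ⟨E, h⟩
    · rw [h]
      exact Relation.ReflTransGen.refl
    · have hE : IsFpfDream z E :=
        h.elim (fun h => (isFpfDream_iff_of_ladderMove h).mpr hD)
          fun h => (isFpfDream_iff_of_fpfLadderMove (even_of_fpf hz) h).mpr hD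
      obtain ⟨h1, h2⟩ := card_weight_of_move h
      have h3 : weight E ≤ n * E.card := by
        rw [mul_comm, ← smul_eq_mul]
        exact Finset.sum_le_card_nsmul _ _ _ fun x hx => by have := hE.inTri x hx; omega
      rw [h1] at hk
      exact (ih _ (by omega) hE rfl).tail h

theorem bottomFpf_mem_FDPlus {n : ℕ} {z : Equiv.Perm (Fin n)} (hz : IsFpfInvolution z) :
    bottomFpf z ∈ FDPlus z := by
  obtain ⟨D, hD⟩ := exists_isFpfDream hz
  exact (mem_FDPlus_iff_of_FDLe (even_of_fpf hz) (bottomFpf_le hz hD)).mpr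
    (coe_mem_FDPlus_iff.mpr hD)

theorem mem_FDPlus_iff_le {n : ℕ} {z : Equiv.Perm (Fin n)} (hz : IsFpfInvolution z)
    {E : Set (ℕ × ℕ)} : E ∈ FDPlus z ↔ FDLe (bottomFpf z) E := by
  constructor
  · intro h
    lift E to Finset (ℕ × ℕ) using finite_of_mem_FDPlus h
    exact bottomFpf_le hz (coe_mem_FDPlus_iff.mp h)
  · intro h
    exact (mem_FDPlus_iff_of_FDLe (even_of_fpf hz) h).mp (bottomFpf_mem_FDPlus hz)

theorem mem_FDPlus_iff_sim {n : ℕ} {z : Equiv.Perm (Fin n)} (hz : IsFpfInvolution z)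
    {E : Set (ℕ × ℕ)} : E ∈ FDPlus z ↔ FDSim (bottomFpf z) E := by
  refine ⟨fun h => Or.inl ((mem_FDPlus_iff_le hz).mp h), fun h => h.elim ?_ ?_⟩
  · exact (mem_FDPlus_iff_le hz).mpr
  · intro h
    exact (mem_FDPlus_iff_of_FDLe (even_of_fpf hz) h).mpr (bottomFpf_mem_FDPlus hz)

theorem isLeast_iff_eq_bottomFpf {n : ℕ} {z : Equiv.Perm (Fin n)} (hz : IsFpfInvolution z)
    (D : Set (ℕ × ℕ)) : (D ∈ FDPlus z ∧ ∀ E ∈ FDPlus z, FDLe D E) ↔ D = bottomFpf z := by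
  constructor
  · rintro ⟨h1, h2⟩
    have h3 := h2 _ (bottomFpf_mem_FDPlus hz)
    have h4 := (mem_FDPlus_iff_le hz).mp h1
    have hB := finite_of_mem_FDPlus (bottomFpf_mem_FDPlus hz)
    lift D to Finset (ℕ × ℕ) using finite_of_mem_FDPlus h1
    rw [← hB.coe_toFinset] at h3 h4 ⊢
    rw [FDLe_antisymm h3 h4]
  · rintro rfl
    exact ⟨bottomFpf_mem_FDPlus hz, fun E hE => (mem_FDPlus_iff_le hz).mp hE⟩

/-! ### The length of a fixed-point-free involution -/

theorem card_lt_apply {n : ℕ} {z : Equiv.Perm (Fin n)} (hz : IsFpfInvolution z) :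
    2 * (Finset.univ.filter fun i => i < z i).card = n := by
  have h1 : (Finset.univ.filter fun i => i < z i).card =
      (Finset.univ.filter fun i => ¬ i < z i).card := by
    refine Finset.card_bij' (fun i _ => z i) (fun i _ => z i) ?_ ?_ ?_ ?_
    · intro i hi
      simp only [Finset.mem_filter, Finset.mem_univ, true_and, hz.1] at hi ⊢
      exact not_lt.mpr hi.le
    · intro i hi
      simp only [Finset.mem_filter, Finset.mem_univ, true_and, hz.1] at hi ⊢
      exact lt_of_le_of_ne (not_lt.mp hi) (hz.2 i)
    · exact fun i _ => hz.1 i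
    · exact fun i _ => hz.1 i
  have h2 := Finset.card_filter_add_card_filter_not (s := (Finset.univ : Finset (Fin n)))
    (fun i => i < z i)
  rw [← h1, Finset.card_univ, Fintype.card_fin] at h2
  omega

/-- Split the inversions `(i, j)` by whether `z j` is below, equal to or above `i`. The map `(i, j)
↦ (z j, z i)` exchanges the outer classes, the first of which is counted by `fpfCode`; the middle
class has one element for each cycle. -/
theorem two_mul_len {n : ℕ} {z : Equiv.Perm (Fin n)} (hz : IsFpfInvolution z) :
    2 * len z = 4 * ∑ i, fpfCode z i + n := by
  set A := Finset.univ.filter fun x : Fin n × Fin n => x.1 < x.2 ∧ z x.2 < z x.1 ∧ z x.2 < x.1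
    with hA
  set B := Finset.univ.filter fun x : Fin n × Fin n => x.1 < x.2 ∧ z x.2 < z x.1 ∧ z x.2 = x.1
    with hB
  set C := Finset.univ.filter fun x : Fin n × Fin n => x.1 < x.2 ∧ z x.2 < z x.1 ∧ x.1 < z x.2
    with hC
  have hcA : A.card = ∑ i, fpfCode z i := by
    simp only [hA, fpfCode, Finset.card_filter, Fintype.sum_prod_type]
  have hcB : B.card = (Finset.univ.filter fun i => i < z i).card := by
    refine Finset.card_bij' (fun x _ => x.1) (fun i _ => (i, z i)) ?_ ?_ ?_ ?_
    · rintro ⟨i, j⟩ h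
      simp only [hB, Finset.mem_filter, Finset.mem_univ, true_and] at h ⊢
      obtain ⟨h1, -, rfl⟩ := h
      rwa [hz.1]
    · intro i h
      simpa [hB, hz.1] using h
    · rintro ⟨i, j⟩ h
      simp only [hB, Finset.mem_filter, Finset.mem_univ, true_and] at h
      obtain ⟨h1, -, rfl⟩ := h
      simp only [hz.1]
    · intro i _
      rfl
  have hcC : C.card = A.card := by
    refine Finset.card_bij' (fun x _ => (z x.2, z x.1)) (fun x _ => (z x.2, z x.1)) ?_ ?_ ?_ ?_
    · rintro ⟨i, j⟩ h
      simp only [hA, hC, Finset.mem_filter, Finset.mem_univ, true_and, hz.1] at h ⊢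
      exact ⟨h.2.1, h.1, h.2.2⟩
    · rintro ⟨i, j⟩ h
      simp only [hA, hC, Finset.mem_filter, Finset.mem_univ, true_and, hz.1] at h ⊢
      exact ⟨h.2.1, h.1, h.2.2⟩
    · rintro ⟨i, j⟩ _
      simp only [hz.1]
    · rintro ⟨i, j⟩ _
      simp only [hz.1]
  have hU : len z = (A ∪ (B ∪ C)).card := by
    rw [len]
    congr 1
    ext x
    simp only [hA, hB, hC, Finset.mem_union, Finset.mem_filter, Finset.mem_univ, true_and]
    have := lt_trichotomy (z x.2) x.1
    tauto
  rw [hU, Finset.card_union_of_disjoint, Finset.card_union_of_disjoint, hcC, hcB, hcA]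
  · have := card_lt_apply hz
    omega
  · rw [hB, hC, Finset.disjoint_filter]
    rintro x - ⟨-, -, h1⟩ ⟨-, -, h2⟩
    exact absurd h1 h2.ne'
  · rw [Finset.disjoint_union_right, hA, hB, hC, Finset.disjoint_filter, Finset.disjoint_filter]
    refine ⟨?_, ?_⟩
    · rintro x - ⟨-, -, h1⟩ ⟨-, -, h2⟩
      exact absurd h2 h1.ne
    · rintro x - ⟨-, -, h1⟩ ⟨-, -, h2⟩
      exact lt_asymm h1 h2

theorem IsFpfDream.card_eq {n : ℕ} {z : Equiv.Perm (Fin n)} {D E : Finset (ℕ × ℕ)}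
    (hD : IsFpfDream z D) (hE : IsFpfDream z E) : D.card = E.card :=
  le_antisymm ((hD.card_le _ hE.conj).trans hE.len_eq.le)
    ((hE.card_le _ hD.conj).trans hD.len_eq.le)

/-- All dreams of atoms have the same number of cells, namely the minimal length, so it suffices to
count the bottom one. -/
theorem IsFpfDream.card_eq_sum {n : ℕ} {z : Equiv.Perm (Fin n)} (hz : IsFpfInvolution z)
    {D : Finset (ℕ × ℕ)} (hD : IsFpfDream z D) : D.card = ∑ i, fpfCode z i := by
  set c : ℕ → ℕ := fun r => if h : r < n then fpfCode z ⟨r, h⟩ else 0 with hcdef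
  have hc : ∀ r < n, r + c r < n := by
    intro r hr
    simp only [hcdef, dif_pos hr]
    have : fpfCode z ⟨r, hr⟩ ≤ (Finset.Ioi (⟨r, hr⟩ : Fin n)).card := by
      refine Finset.card_le_card fun j hj => ?_
      simp only [Finset.mem_filter] at hj
      exact Finset.mem_Ioi.mpr hj.2.1
    rw [Fin.card_Ioi] at this
    simp only at this
    omega
  have e : ((leftJust n c : Finset (ℕ × ℕ)) : Set (ℕ × ℕ)) = bottomFpf z := by
    ext x
    rw [Finset.mem_coe, mem_leftJust hc, bottomFpf, Set.mem_ofPred_eq]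
    constructor
    · rintro ⟨h1, h2⟩
      exact ⟨h1, by simpa only [hcdef, dif_pos h1] using h2⟩
    · rintro ⟨h1, h2⟩
      exact ⟨h1, by simpa only [hcdef, dif_pos h1] using h2⟩
  have hB := bottomFpf_mem_FDPlus hz
  rw [← e, coe_mem_FDPlus_iff] at hB
  rw [hD.card_eq hB, card_leftJust hc]
  refine Finset.sum_congr rfl fun i _ => ?_
  simp only [hcdef, dif_pos i.2]

/-! ### Symmetric pipe dreams -/

theorem dreamPerm_diagonal_apply {n : ℕ} {D : Finset (ℕ × ℕ)} (hD : InTri n D)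
    (hd : ∀ x ∈ D, x.1 = x.2) (j : Fin n) : (dreamPerm n D j).1 =
      if (j.1 / 2, j.1 / 2) ∈ D then (if j.1 % 2 = 1 then j.1 - 1 else j.1 + 1) else j.1 := by
  induction D using Finset.strongInduction with
  | H D ih =>
    rcases D.eq_empty_or_nonempty with rfl | ⟨⟨i, i'⟩, hx⟩
    · simp [dreamPerm_empty]
    · obtain rfl : i = i' := hd _ hx
      have hi := hD _ hx
      simp only at hi
      have e : dreamPerm n D = adj n (i + i) * dreamPerm n (D.erase (i, i)) := by
        refine dreamPerm_eq_adj_mul_erase n hx fun y hy h1 h2 h3 => ?_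
        have := hd y hy
        exact absurd (Prod.ext (by simp only at h1 h2 ⊢; omega) (by simp only at h1 h2 ⊢; omega)) h3
      rw [e, Equiv.Perm.mul_apply, adj_val (by omega), ih _ (Finset.erase_ssubset hx)
        (fun x hx => hD x (Finset.mem_of_mem_erase hx)) fun x hx => hd x (Finset.mem_of_mem_erase hx)]
      by_cases hj : j.1 / 2 = i
      · subst hj
        simp only [Finset.mem_erase, ne_eq, not_true_eq_false, false_and, if_false, hx, if_true]
        split_ifs <;> omega
      · have : (j.1 / 2, j.1 / 2) ∈ D.erase (i, i) ↔ (j.1 / 2, j.1 / 2) ∈ D := by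
          simp [hj]
        simp only [this]
        split_ifs <;> omega

/-- The cells of the main diagonal in the triangle. -/
def diagonal (n : ℕ) : Finset (ℕ × ℕ) := (Finset.range (n / 2)).image fun i => (i, i)

theorem mem_diagonal {n : ℕ} {x : ℕ × ℕ} : x ∈ diagonal n ↔ x.1 = x.2 ∧ x.1 + x.2 + 2 ≤ n := by
  simp only [diagonal, Finset.mem_image, Finset.mem_range]
  constructor
  · rintro ⟨i, hi, rfl⟩
    simp only [true_and]
    omega
  · rintro ⟨h1, h2⟩
    exact ⟨x.1, by omega, Prod.ext rfl h1⟩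

theorem card_diagonal (n : ℕ) : (diagonal n).card = n / 2 := by
  rw [diagonal, Finset.card_image_of_injective _ fun a b h => congrArg Prod.fst h, Finset.card_range]

theorem inTri_diagonal (n : ℕ) : InTri n (diagonal n) := fun _ hx => (mem_diagonal.mp hx).2

theorem dreamPerm_diagonal {n : ℕ} (hn : Even n) : dreamPerm n (diagonal n) = fpfBase n := by
  refine Equiv.ext fun j => Fin.ext ?_
  rw [dreamPerm_diagonal_apply (inTri_diagonal n) fun x hx => (mem_diagonal.mp hx).1,
    fpfBase_val hn, if_pos]
  rw [mem_diagonal]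
  have := j.2
  rw [Nat.even_iff] at hn
  simp only [true_and]
  omega

/-- The cells of `L`, their transposes and the cells of `Δ`. -/
def symmetrize (L Δ : Finset (ℕ × ℕ)) : Finset (ℕ × ℕ) := L.image Prod.swap ∪ (Δ ∪ L)

theorem mem_symmetrize {L Δ : Finset (ℕ × ℕ)} {x : ℕ × ℕ} :
    x ∈ symmetrize L Δ ↔ x.swap ∈ L ∨ x ∈ Δ ∨ x ∈ L := by
  simp only [symmetrize, Finset.mem_union, Finset.mem_image]
  refine or_congr_left ⟨?_, fun h => ⟨_, h, Prod.swap_swap x⟩⟩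
  rintro ⟨y, hy, rfl⟩
  rwa [Prod.swap_swap]

/-- The cells above the diagonal can be read first, then the diagonal, then those below; the upper
part contributes the inverse of the lower part. -/
theorem dreamPerm_symmetrize (n : ℕ) {L Δ : Finset (ℕ × ℕ)} (hL : ∀ x ∈ L, x.2 < x.1)
    (hΔ : ∀ x ∈ Δ, x.1 = x.2) :
    dreamPerm n (symmetrize L Δ) = (dreamPerm n L)⁻¹ * (dreamPerm n Δ * dreamPerm n L) := by
  rw [symmetrize, dreamPerm_union_of_lt, dreamPerm_union_of_lt, dreamPerm_swap]
  · intro x hx y hy hyx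
    have := hΔ x hx
    have := hL y hy
    omega
  · intro x hx y hy hyx
    rw [Finset.mem_image] at hx
    obtain ⟨x, hx, rfl⟩ := hx
    have := hL x hx
    simp only [Prod.fst_swap, Prod.snd_swap] at hyx ⊢
    rcases Finset.mem_union.mp hy with hy | hy
    · have := hΔ y hy
      omega
    · have := hL y hy
      omega

theorem card_symmetrize {L Δ : Finset (ℕ × ℕ)} (hL : ∀ x ∈ L, x.2 < x.1)
    (hΔ : ∀ x ∈ Δ, x.1 = x.2) : (symmetrize L Δ).card = 2 * L.card + Δ.card := by
  rw [symmetrize, Finset.card_union_of_disjoint, Finset.card_union_of_disjoint,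
    Finset.card_image_of_injective _ Prod.swap_injective]
  · omega
  · rw [Finset.disjoint_left]
    intro x hx hx'
    have := hΔ x hx
    have := hL x hx'
    omega
  · rw [Finset.disjoint_left]
    intro x hx hx'
    rw [Finset.mem_image] at hx
    obtain ⟨x, hx, rfl⟩ := hx
    have := hL x hx
    rcases Finset.mem_union.mp hx' with hy | hy
    · have := hΔ _ hy
      simp only [Prod.fst_swap, Prod.snd_swap] at this
      omega
    · have := hL _ hy
      simp only [Prod.fst_swap, Prod.snd_swap] at this
      omega

/-- Symmetrization with the full diagonal and restriction to the strict lower triangle are mutually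
inverse. The products correspond by `dreamPerm_symmetrize`, the cell counts by `two_mul_len`. -/
theorem mem_FD_iff {n : ℕ} {z : Equiv.Perm (Fin n)} (hz : IsFpfInvolution z) {E : Set (ℕ × ℕ)} :
    E ∈ FD z ↔ E ⊆ strictLowerTriangle n ∧ E ∈ FDPlus z := by
  classical
  have hn := even_of_fpf hz
  have hn' := Nat.even_iff.mp hn
  have hlen := two_mul_len hz
  constructor
  · rintro ⟨D, hD, hsymm, rfl⟩
    refine ⟨Set.inter_subset_right, ?_⟩
    lift D to Finset (ℕ × ℕ) using (finite_upperTriangle n).subset hD.1.1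
    rw [mem_PD_iff] at hD
    obtain ⟨hT, hzD, hcard⟩ := hD
    set L := D.filter fun x => x.2 < x.1 with hLdef
    set Δ := D.filter fun x => x.1 = x.2 with hΔdef
    have hL : ∀ x ∈ L, x.2 < x.1 := fun x hx => (Finset.mem_filter.mp hx).2
    have hΔ : ∀ x ∈ Δ, x.1 = x.2 := fun x hx => (Finset.mem_filter.mp hx).2
    have hDs : D = symmetrize L Δ := by
      ext ⟨i, j⟩
      have h1 : (i, j) ∈ D ↔ (j, i) ∈ D := ⟨hsymm i j, hsymm j i⟩
      simp only [mem_symmetrize, hLdef, hΔdef, Finset.mem_filter, Prod.swap_prod_mk, ← h1,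
        ← and_or_left]
      have := lt_trichotomy i j
      tauto
    have hTΔ : InTri n Δ := fun x hx => hT x (Finset.mem_filter.mp hx).1
    have hP := dreamPerm_symmetrize n hL hΔ
    rw [← hDs, hzD] at hP
    -- If `(i, i)` were missing, the diagonal product would fix `2 * i`, and its preimage under the
    -- product of `L` would be a fixed point of `z`.
    have hfull : Δ = diagonal n := by
      ext ⟨i, i'⟩
      rw [mem_diagonal]
      refine ⟨fun hx => ⟨hΔ _ hx, hTΔ _ hx⟩, ?_⟩
      simp only
      rintro ⟨rfl, hi⟩
      by_contra hnot
      have h1 := dreamPerm_diagonal_apply hTΔ hΔ ⟨2 * i, by omega⟩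
      have h2 : 2 * i / 2 = i := by omega
      simp only [h2, hnot, if_false] at h1
      have h3 := congrArg (fun w => w ((dreamPerm n L)⁻¹ ⟨2 * i, by omega⟩)) hP
      have h4 : dreamPerm n L ((dreamPerm n L)⁻¹ ⟨2 * i, by omega⟩) = ⟨2 * i, by omega⟩ :=
        (dreamPerm n L).apply_symm_apply _
      simp only [Equiv.Perm.mul_apply, h4] at h3
      have h5 : dreamPerm n Δ ⟨2 * i, by omega⟩ = ⟨2 * i, by omega⟩ := Fin.ext h1
      rw [h5] at h3
      exact hz.2 _ h3
    have hLE : ((L : Finset (ℕ × ℕ)) : Set (ℕ × ℕ)) = ↑D ∩ strictLowerTriangle n := by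
      ext x
      simp only [hLdef, Finset.coe_filter, Set.mem_ofPred_eq, Set.mem_inter_iff, Finset.mem_coe,
        strictLowerTriangle]
      refine and_congr_right fun hx => ?_
      have := hT x hx
      omega
    have hconj : Conj z (dreamPerm n L) := by
      rw [Conj, mul_assoc, ← dreamPerm_diagonal hn, ← hfull]
      exact hP
    rw [← hLE, coe_mem_FDPlus_iff]
    refine ⟨fun x hx => hT x (Finset.mem_filter.mp hx).1, hconj, fun v hv => ?_⟩
    obtain ⟨B, hB⟩ := exists_isFpfDream hz
    refine le_trans (le_of_eq ?_) (hB.card_le v hv)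
    -- Reducedness of `D` gives `len z = 2 * L.card + n / 2`; comparison with `two_mul_len` shows
    -- that `L` has the minimal number of cells.
    have h5 := card_symmetrize hL hΔ
    rw [← hDs, hfull, card_diagonal, ← hcard] at h5
    rw [hB.card_eq_sum hz]
    omega
  · rintro ⟨hE, hEF⟩
    lift E to Finset (ℕ × ℕ) using finite_of_mem_FDPlus hEF
    rw [coe_mem_FDPlus_iff] at hEF
    have hL : ∀ x ∈ E, x.2 < x.1 := fun x hx => (hE hx).2
    have hΔ : ∀ x ∈ diagonal n, x.1 = x.2 := fun x hx => (mem_diagonal.mp hx).1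
    refine ⟨(symmetrize E (diagonal n) : Finset (ℕ × ℕ)), ?_, ?_, ?_⟩
    · rw [mem_PD_iff]
      refine ⟨?_, ?_, ?_⟩
      · intro x hx
        rcases mem_symmetrize.mp hx with hx | hx | hx
        · have := hEF.inTri _ hx
          simp only [Prod.fst_swap, Prod.snd_swap] at this
          omega
        · exact inTri_diagonal n x hx
        · exact hEF.inTri x hx
      · rw [dreamPerm_symmetrize n hL hΔ, dreamPerm_diagonal hn, ← mul_assoc]
        exact hEF.conj.symm
      · rw [card_symmetrize hL hΔ, card_diagonal, hEF.card_eq_sum hz]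
        omega
    · intro i j h
      rw [Finset.mem_coe, mem_symmetrize, Prod.swap_prod_mk, mem_diagonal] at h ⊢
      simp only at h ⊢
      rcases h with h | h | h
      · exact Or.inr (Or.inr h)
      · exact Or.inr (Or.inl (by omega))
      · exact Or.inl h
    · ext x
      constructor
      · intro hx
        exact ⟨mem_symmetrize.mpr (Or.inr (Or.inr hx)), hE hx⟩
      · rintro ⟨hx, hx'⟩
        have hlt : x.2 < x.1 := hx'.2
        rcases mem_symmetrize.mp hx with hx | hx | hx
        · have := hL _ hx
          simp only [Prod.fst_swap, Prod.snd_swap] at this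
          omega
        · have := hΔ x hx
          omega
        · exact hx

end FpfPipe

theorem theorem5p14 (n : ℕ) (z : Equiv.Perm (Fin n)) (hz : FpfPipe.IsFpfInvolution z) :
    -- the set `FD⁺(z)` is generated from the bottom element
    FpfPipe.FDPlus z = {E | FpfPipe.FDLe (FpfPipe.bottomFpf z) E} ∧
    FpfPipe.FDPlus z = {E | FpfPipe.FDSim (FpfPipe.bottomFpf z) E} ∧
    -- it is an upper and a lower set, and the bottom element is its unique minimum
    (∀ D E : Set (ℕ × ℕ), FpfPipe.FDLe D E →
      (D ∈ FpfPipe.FDPlus z ↔ E ∈ FpfPipe.FDPlus z)) ∧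
    (∀ D : Set (ℕ × ℕ),
      (D ∈ FpfPipe.FDPlus z ∧ ∀ E ∈ FpfPipe.FDPlus z, FpfPipe.FDLe D E) ↔
        D = FpfPipe.bottomFpf z) ∧
    -- the set `FD(z)`
    FpfPipe.FD z =
      {E | E ⊆ FpfPipe.strictLowerTriangle n ∧ FpfPipe.FDLe (FpfPipe.bottomFpf z) E} ∧
    FpfPipe.FD z =
      {E | E ⊆ FpfPipe.strictLowerTriangle n ∧ FpfPipe.FDSim (FpfPipe.bottomFpf z) E} := by
  refine ⟨?_, ?_, ?_, FpfPipe.isLeast_iff_eq_bottomFpf hz, ?_, ?_⟩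
  · exact Set.ext fun E => FpfPipe.mem_FDPlus_iff_le hz
  · exact Set.ext fun E => FpfPipe.mem_FDPlus_iff_sim hz
  · exact fun D E h => FpfPipe.mem_FDPlus_iff_of_FDLe (FpfPipe.even_of_fpf hz) h
  · exact Set.ext fun E => (FpfPipe.mem_FD_iff hz).trans
      (and_congr_right fun _ => FpfPipe.mem_FDPlus_iff_le hz)
  · exact Set.ext fun E => (FpfPipe.mem_FD_iff hz).trans
      (and_congr_right fun _ => FpfPipe.mem_FDPlus_iff_sim hz)
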